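/- Let $\mathcal E_\omega(\rho)=\sum_{j=1}^r K_j(\omega)\rho K_j(\omega)^\dagger$ be quantum channels from $\mathbb C^{d\times d}$ to $\mathbb C^{d'\times d'}$ depending on a real parameter $\omega$, with $\sum_j K_j^\dagger K_j=I$ near the true value of $\omega$ and with Kraus operators that are differentiable there (derivative in $\omega$ denoted by a dot). Put $$H=i\sum_j K_j^\dagger\dot K_j,\qquad \mathcal S=\{S=S^\dagger:\ S\in\mathrm{span}_{\mathbb C}\{K_i^\dagger K_j\}\},\qquad \beta(h)=i\sum_j K_j^\dagger\Big(\dot K_j-i\sum_l h_{jl}K_l\Big)\quad(h\in\mathbb C^{r\times r}\text{ Hermitian}).$$ For a differentiable family of states, $F(\rho_\omega)=\mathrm{Tr}(L^2\rho_\omega)$, where $L=L^\dagger$ and $\dot\rho_\omega=\tfrac12(\rho_\omega L+L\rho_\omega)$, is the quantum Fisher information. Let $\mathfrak F_N=\sup_\rho F\big((\mathcal E_\omega^{\otimes N}\otimes\mathbb 1)(\rho)\big)$, over all states $\rho$ of the $N$ probes and an ancilla of arbitrary finite dimension. Let $\|\cdot\|$ be the operator norm and $\|\cdot\|_1$ the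 trace norm. Theorem. Suppose $H\notin\mathcal S$ (at the true value of $\omega$). Then every $\mathfrak F_N$ is finite and $$\mathfrak F_{\rm HL}:=\lim_{N\to\infty}\frac{\mathfrak F_N}{N^2}=4\min_{h}\|\beta(h)\|^2=4\min_{S\in\mathcal S}\|H-S\|^2 ,$$ where both minima are attained. Moreover this value is attained by logical GHZ states that are computed by a semidefinite program: (a) The problem of maximizing $|\mathrm{Tr}(H\tilde C)|$ over Hermitian $\tilde C\in\mathbb C^{d\times d}$ with $\|\tilde C\|_1\le 2$ and $\mathrm{Tr}(\tilde CS)=0$ for all $S\in\mathcal S$ has the maximal value $2\min_{S\in\mathcal S}\|H-S\|$, and it is solved by a semidefinite program: the program of maximizing $\mathrm{Tr}(H(X-Y))$ over $X,Y\succeq0$ with $\mathrm{Tr}(X+Y)\le2$ and $\mathrm{Tr}((X-Y)K_i^\dagger K_j)=0$ for all $i,j$ has a solution, and $\tilde C=X-Y$ is a maximizer for each of its solutions $(X,Y)$. (b) For every maximizer $\tilde C$ there are $A_0,A_1\in\mathbb C^{d\times d}$ with $\mathrm{Tr}(A_0^\dagger A_0)=\mathrm{Tr}(A_1^\dagger A_1)=1$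 and $A_0A_0^\dagger-A_1A_1^\dagger=\tilde C$. (c) For all $A_0,A_1$ with $\mathrm{Tr}(A_0^\dagger A_0)=\mathrm{Tr}(A_1^\dagger A_1)=1$ for which $A_0A_0^\dagger-A_1A_1^\dagger$ is a maximizer, the code spanned by $|b_{\rm L}\rangle=\sum_{i,j}(A_b)_{ij}|i\rangle|j,b\rangle$, $b=0,1$ (one probe and an ancilla of dimension $2d$) satisfies the Knill–Laflamme condition: with $P=|0_{\rm L}\rangle\langle0_{\rm L}|+|1_{\rm L}\rangle\langle1_{\rm L}|$, each $P(K_i^\dagger K_j\otimes\mathbb 1)P$ is a multiple of $P$. The logical GHZ states $|\psi_N\rangle=\tfrac1{\sqrt2}(|0_{\rm L}\rangle^{\otimes N}+|1_{\rm L}\rangle^{\otimes N})$ satisfy $$F\big((\mathcal E_\omega^{\otimes N}\otimes\mathbb 1)(|\psi_N\rangle\langle\psi_N|)\big)\ \ge\ N^2\,\mathfrak F_{\rm HL}\quad\text{for all }N\ge1,\qquad \lim_{N\to\infty}\frac{F\big((\mathcal E_\omega^{\otimes N}\otimes\mathbb 1)(|\psi_N\rangle\langle\psi_N|)\big)}{N^2}=\mathfrak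 F_{\rm HL}.$$ -/

import Mathlib

open scoped Kronecker Topology ComplexOrder
open Filter

noncomputable section

namespace ChannelMetrology

/-- Entrywise derivative at `ω` of a curve of matrices. -/
def matDeriv {m n : Type*} (A : ℝ → Matrix m n ℂ) (ω : ℝ) : Matrix m n ℂ :=
  Matrix.of fun a b => deriv (fun t => A t a b) ω

/-- Operator norm of a square matrix acting on the Euclidean space `ℂⁿ`. -/
def opNorm {n : Type*} [Fintype n] [DecidableEq n] (A : Matrix n n ℂ) : ℝ :=
  ‖Matrix.toEuclideanCLM (n := n) (𝕜 := ℂ) A‖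

/-- Trace norm of a square matrix: the sum of its singular values. -/
def traceNorm {n : Type*} [Fintype n] [DecidableEq n] (A : Matrix n n ℂ) : ℝ :=
  ∑ i, Real.sqrt ((Matrix.isHermitian_conjTranspose_mul_self A).eigenvalues i)

/-- Density matrices. -/
def IsDensity {n : Type*} [Fintype n] (ρ : Matrix n n ℂ) : Prop :=
  ρ.PosSemidef ∧ ρ.trace = 1

section FisherInformation

variable {n : Type*} [Fintype n]

/-- `L` is a symmetric logarithmic derivative of a curve of states which is at `ρ` and has
velocity `ρ'`. -/
def IsSLD (ρ ρ' L : Matrix n n ℂ) : Prop :=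
  L.IsHermitian ∧ ρ' = (1 / 2 : ℂ) • (ρ * L + L * ρ)

open Classical in
/-- Quantum Fisher information `Tr (L² ρ)` of a curve of states at `ω`, where `L` is a symmetric
logarithmic derivative. An `L` exists as soon as the curve is differentiable at `ω` and positive
semidefinite near `ω`; the value does not depend on the choice of `L` (see `qfi_eq`). -/
def qfi (ρ : ℝ → Matrix n n ℂ) (ω : ℝ) : ℝ :=
  if h : ∃ L, IsSLD (ρ ω) (matDeriv ρ ω) L then (h.choose * h.choose * ρ ω).trace.re else 0

theorem IsSLD.trace_eq {ρ ρ' L M : Matrix n n ℂ} (hL : IsSLD ρ ρ' L) (hM : IsSLD ρ ρ' M) :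
    (L * L * ρ).trace = (M * M * ρ).trace := by
  have key : ∀ X Y : Matrix n n ℂ, IsSLD ρ ρ' Y →
      (X * ρ').trace = (1 / 2 : ℂ) * ((X * Y * ρ).trace + (Y * X * ρ).trace) := by
    intro X Y hY
    rw [hY.2, Matrix.mul_smul, Matrix.trace_smul, Matrix.mul_add, Matrix.trace_add, smul_eq_mul,
      ← Matrix.mul_assoc, ← Matrix.mul_assoc, Matrix.trace_mul_cycle X ρ Y, add_comm]
  have h1 := key L L hL
  have h2 := key L M hM
  have h3 := key M L hL
  have h4 := key M M hM
  linear_combination h4 + h2 - h1 - h3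

/-- The quantum Fisher information may be computed with any symmetric logarithmic derivative. -/
theorem qfi_eq (ρ : ℝ → Matrix n n ℂ) (ω : ℝ) (L : Matrix n n ℂ)
    (hL : IsSLD (ρ ω) (matDeriv ρ ω) L) : qfi ρ ω = (L * L * ρ ω).trace.re := by
  have h : ∃ L, IsSLD (ρ ω) (matDeriv ρ ω) L := ⟨L, hL⟩
  rw [qfi, dif_pos h, IsSLD.trace_eq h.choose_spec hL]

end FisherInformation

section Channels

variable {ι m n a : Type*} [Fintype ι] [Fintype m] [Fintype n] [Fintype a] [DecidableEq n]
  [DecidableEq a]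

/-- The operators `K i` are the Kraus operators of a trace-preserving channel. -/
def IsKraus (K : ι → Matrix m n ℂ) : Prop :=
  ∑ i, (K i).conjTranspose * K i = 1

/-- The output `(ℰ ⊗ 𝟙) (ρ)`, where `ℰ` is the channel with Kraus operators `K` and the identity
channel acts on the ancilla, whose basis is labelled by `a`. -/
def applyChannel (K : ι → Matrix m n ℂ) (ρ : Matrix (n × a) (n × a) ℂ) :
    Matrix (m × a) (m × a) ℂ :=
  ∑ i, (K i ⊗ₖ (1 : Matrix a a ℂ)) * ρ * (K i ⊗ₖ (1 : Matrix a a ℂ)).conjTranspose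

/-- The Kraus operators `K i₁ ⊗ ⋯ ⊗ K i_N` of the `N`-fold tensor power of a channel. -/
def tensorPow {ι m n : Type*} (N : ℕ) (K : ι → Matrix m n ℂ) :
    (Fin N → ι) → Matrix (Fin N → m) (Fin N → n) ℂ :=
  fun s => Matrix.of fun x y => ∏ k, K (s k) (x k) (y k)

end Channels

section Metrology

variable {d d' r : ℕ}

/-- The quantum Fisher informations of the outputs `(ℰ_ω^{⊗N} ⊗ 𝟙) (ρ)` at `ω`, over all
ancilla dimensions and all input states `ρ` of probe and ancilla. -/
def parallelQFISet (K : ℝ → Fin r → Matrix (Fin d') (Fin d) ℂ) (ω : ℝ) (N : ℕ) : Set ℝ :=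
  {x | ∃ (a : ℕ) (ρ : Matrix ((Fin N → Fin d) × Fin a) ((Fin N → Fin d) × Fin a) ℂ),
    IsDensity ρ ∧ x = qfi (fun t => applyChannel (tensorPow N (K t)) ρ) ω}

/-- The entanglement-assisted quantum Fisher information of `N` parallel uses of the channel. -/
def parallelQFI (K : ℝ → Fin r → Matrix (Fin d') (Fin d) ℂ) (ω : ℝ) (N : ℕ) : ℝ :=
  sSup (parallelQFISet K ω N)

/-- `H = i ∑ⱼ Kⱼ† K̇ⱼ`. -/
def krausHamiltonian (K : ℝ → Fin r → Matrix (Fin d') (Fin d) ℂ) (ω : ℝ) :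
    Matrix (Fin d) (Fin d) ℂ :=
  Complex.I • ∑ j, (K ω j).conjTranspose * matDeriv (fun t => K t j) ω

/-- The Kraus span: the Hermitian matrices that are linear combinations of the `Kᵢ† Kⱼ`. -/
def krausSpan (K : Fin r → Matrix (Fin d') (Fin d) ℂ) : Set (Matrix (Fin d) (Fin d) ℂ) :=
  {S | S.IsHermitian ∧ S ∈ Submodule.span ℂ {A | ∃ i j, A = (K i).conjTranspose * K j}}

/-- `β = i ∑ⱼ Kⱼ† (K̇ⱼ - i ∑ₗ hⱼₗ Kₗ)`. -/
def krausBeta (K : ℝ → Fin r → Matrix (Fin d') (Fin d) ℂ) (ω : ℝ) (h : Matrix (Fin r) (Fin r) ℂ) :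
    Matrix (Fin d) (Fin d) ℂ :=
  Complex.I • ∑ j, (K ω j).conjTranspose *
    (matDeriv (fun t => K t j) ω - Complex.I • ∑ l, h j l • K ω l)

/-- Feasible points of the trace-norm program: Hermitian matrices of trace norm at most `2` that
are orthogonal to the Kraus span. -/
def CodeFeasible (K : Fin r → Matrix (Fin d') (Fin d) ℂ) : Set (Matrix (Fin d) (Fin d) ℂ) :=
  {C | C.IsHermitian ∧ traceNorm C ≤ 2 ∧ ∀ S ∈ krausSpan K, (C * S).trace = 0}

/-- `C` maximizes `|Tr (H C)|` over the feasible points of the trace-norm program. -/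
def IsCodeOptimal (K : ℝ → Fin r → Matrix (Fin d') (Fin d) ℂ) (ω : ℝ)
    (C : Matrix (Fin d) (Fin d) ℂ) : Prop :=
  C ∈ CodeFeasible (K ω) ∧ ∀ C' ∈ CodeFeasible (K ω),
    ‖(krausHamiltonian K ω * C').trace‖ ≤ ‖(krausHamiltonian K ω * C).trace‖

/-- Feasible points `(X, Y)` of the semidefinite program. -/
def SDPFeasible (K : Fin r → Matrix (Fin d') (Fin d) ℂ) :
    Set (Matrix (Fin d) (Fin d) ℂ × Matrix (Fin d) (Fin d) ℂ) :=
  {p | p.1.PosSemidef ∧ p.2.PosSemidef ∧ (p.1 + p.2).trace.re ≤ 2 ∧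
    ∀ i j, ((p.1 - p.2) * ((K i).conjTranspose * K j)).trace = 0}

/-- `(X, Y)` maximizes the linear functional `Tr (H (X - Y))` over the feasible points of the
semidefinite program. -/
def IsSDPOptimal (K : ℝ → Fin r → Matrix (Fin d') (Fin d) ℂ) (ω : ℝ)
    (p : Matrix (Fin d) (Fin d) ℂ × Matrix (Fin d) (Fin d) ℂ) : Prop :=
  p ∈ SDPFeasible (K ω) ∧ ∀ q ∈ SDPFeasible (K ω),
    (krausHamiltonian K ω * (q.1 - q.2)).trace.re ≤ (krausHamiltonian K ω * (p.1 - p.2)).trace.re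

/-- The logical basis state `∑ᵢⱼ Aᵢⱼ |i⟩ |j, b⟩` of a probe and an ancilla; the ancilla consists
of a copy of the probe and a qubit. -/
def logicalKet (A : Matrix (Fin d) (Fin d) ℂ) (b : Fin 2) : Fin d × (Fin d × Fin 2) → ℂ :=
  fun x => if x.2.2 = b then A x.1 x.2.1 else 0

/-- The matrix `|ψ⟩⟨ψ|`. -/
def ketBra {n : Type*} (ψ : n → ℂ) : Matrix n n ℂ := Matrix.vecMulVec ψ (star ψ)

/-- `P = |0_L⟩⟨0_L| + |1_L⟩⟨1_L|`. -/
def codeProj (A₀ A₁ : Matrix (Fin d) (Fin d) ℂ) :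
    Matrix (Fin d × (Fin d × Fin 2)) (Fin d × (Fin d × Fin 2)) ℂ :=
  ketBra (logicalKet A₀ 0) + ketBra (logicalKet A₁ 1)

/-- Knill-Laflamme condition: `P (Kᵢ† Kⱼ ⊗ 𝟙) P` is a multiple of `P` for all `i`, `j`. -/
def KnillLaflamme (K : Fin r → Matrix (Fin d') (Fin d) ℂ) (A₀ A₁ : Matrix (Fin d) (Fin d) ℂ) :
    Prop :=
  ∀ i j, ∃ c : ℂ, codeProj A₀ A₁ *
    (((K i).conjTranspose * K j) ⊗ₖ (1 : Matrix (Fin d × Fin 2) (Fin d × Fin 2) ℂ)) *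
      codeProj A₀ A₁ = c • codeProj A₀ A₁

/-- The logical GHZ state `(|0_L⟩^{⊗N} + |1_L⟩^{⊗N}) / √2`, with the `N` probes collected in the
first tensor factor and the `N` ancillas in the second. -/
def logicalGHZ (A₀ A₁ : Matrix (Fin d) (Fin d) ℂ) (N : ℕ) :
    (Fin N → Fin d) × (Fin N → Fin d × Fin 2) → ℂ :=
  fun x => ((Real.sqrt 2 : ℝ) : ℂ)⁻¹ *
    (∏ k, logicalKet A₀ 0 (x.1 k, x.2 k) + ∏ k, logicalKet A₁ 1 (x.1 k, x.2 k))

/-- Quantum Fisher information of `(ℰ_ω^{⊗N} ⊗ 𝟙) (|ψ⟩⟨ψ|)` for the logical GHZ state `ψ`. -/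
def ghzQFI (K : ℝ → Fin r → Matrix (Fin d') (Fin d) ℂ) (ω : ℝ)
    (A₀ A₁ : Matrix (Fin d) (Fin d) ℂ) (N : ℕ) : ℝ :=
  qfi (fun t => applyChannel (tensorPow N (K t)) (ketBra (logicalGHZ A₀ A₁ N))) ω

end Metrology

end ChannelMetrology

end

open ChannelMetrology

/-!
Write `m = min_{S ∈ 𝒮} ‖H - S‖`; the claim is that the asymptotic value is `4 m²`. Since
`β(h) = H + ∑ hⱼₗ Kⱼ† Kₗ`, the matrices `β(h)` are exactly the differences `H - S`
(`mem_krausSpan_iff`, `krausBeta_eq`), so both minima are `m`.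

*Upper bound.* The velocity of the output state does not change if the velocities `K̇ⱼ` are replaced
by `Dⱼ = K̇ⱼ - i ∑ hⱼₗ Kₗ` in every tensor factor (`outputVelocity_gauge`). For a state
`σ = ∑ Mₛ ρ Mₛ†` with velocity `∑ (Eₛ ρ Mₛ† + h.c.)`, positivity of
`∑ (L Mₛ - 2 Eₛ) ρ (L Mₛ - 2 Eₛ)†` gives `Tr (L² σ) ≤ 4 Tr (ρ ∑ Eₛ† Eₛ)` (`IsSLD.trace_le`). For `N`
parallel channels `∑ Eₛ† Eₛ` consists of `N` one-site terms and of at most `N²` products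
`β(h) ⊗ β(h)` on two sites (`norm_sum_tensorReplace_le`), so that the Fisher information is at most
`O(N) + 4 N² ‖β(h)‖²`.

*Duality.* By the Hahn-Banach theorem in the quotient by the span of the `Kᵢ† Kⱼ`, the distance `m` is
`Tr (H C)` for a Hermitian `C` of trace norm at most one which annihilates the span; the trace norm
is bounded by testing the functional on the sign of `C` (`exists_dual_certificate`). The Jordan
decomposition turns `2 C` into a solution of the semidefinite program, of value `2 m`, and turns
every maximizer into a code, because a maximizer has trace zero and trace norm two.

*Lower bound.* For every Hermitian `X` the Fisher information is at least
`2 Tr (X σ') - Tr (X² σ)` (`IsSLD.le_trace`). For a code with `A₀ A₀† - A₁ A₁†` orthogonal to the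
`Kᵢ† Kⱼ`, the error vectors `Kₛ |0_L⟩^{⊗N}` and `Kₛ |1_L⟩^{⊗N}` have the same Gram matrix, and they are
orthogonal to each other thanks to the ancilla qubit. Hence a Hermitian operator, built from a partial
isometry, exchanges the two families up to phases `±i` (`exists_hermitian_exchange`); a multiple of it
is the observable `X`, which needs no explicit recovery operation, and yields the lower bound
`N² Tr (H C)²` for the logical GHZ state (`le_ghzQFI`).
-/

open scoped Matrix.Norms.L2Operator MatrixOrder

namespace ChannelMetrology

/-! ### Trace norm and operator norm -/

section TraceNorm

variable {n : Type*} [Fintype n] [DecidableEq n]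

/-- Hölder's inequality for the operator norm and a positive semidefinite matrix, whose trace norm is
its trace. -/
theorem norm_trace_mul_le {X : Matrix n n ℂ} (hX : X.PosSemidef) (Z : Matrix n n ℂ) :
    ‖(Z * X).trace‖ ≤ ‖Z‖ * X.trace.re := by
  obtain ⟨B, rfl⟩ := CStarAlgebra.nonneg_iff_eq_mul_star_self.mp hX.nonneg
  rw [Matrix.star_eq_conjTranspose]
  set v : n → EuclideanSpace ℂ n := fun i => WithLp.toLp 2 (fun a => B a i) with hv
  have h1 : (Z * (B * B.conjTranspose)).trace
      = ∑ i, inner ℂ (v i) (Matrix.toEuclideanCLM (n := n) (𝕜 := ℂ) Z (v i)) := by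
    rw [← Matrix.mul_assoc, Matrix.trace_mul_comm, Matrix.trace]
    refine Finset.sum_congr rfl fun i _ => ?_
    simp [hv, Matrix.mul_apply, PiLp.inner_apply, Matrix.mulVec, dotProduct, mul_comm]
  have h2 : (B * B.conjTranspose).trace.re = ∑ i, ‖v i‖ ^ 2 := by
    rw [Matrix.trace_mul_comm, Matrix.trace, Complex.re_sum]
    refine Finset.sum_congr rfl fun i _ => ?_
    simp [hv, Matrix.mul_apply, EuclideanSpace.norm_sq_eq, Complex.sq_norm, Complex.normSq_apply]
  rw [h1, h2, Finset.mul_sum]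
  refine (norm_sum_le _ _).trans (Finset.sum_le_sum fun i _ => ?_)
  calc _ ≤ ‖v i‖ * ‖Matrix.toEuclideanCLM (n := n) (𝕜 := ℂ) Z (v i)‖ := norm_inner_le_norm _ _
    _ ≤ ‖v i‖ * (‖Z‖ * ‖v i‖) := by
      gcongr
      exact ContinuousLinearMap.le_opNorm _ _
    _ = _ := by ring

theorem trace_cfc {A : Matrix n n ℂ} (hA : A.IsHermitian) (f : ℝ → ℝ) :
    (cfc f A).trace = ∑ i, (f (hA.eigenvalues i) : ℂ) := by
  rw [hA.cfc_eq, Matrix.IsHermitian.cfc, Unitary.conjStarAlgAut_apply, Matrix.trace_mul_cycle]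
  simp [Matrix.trace]

theorem ofReal_traceNorm (A : Matrix n n ℂ) : (traceNorm A : ℂ) = (CFC.abs A).trace := by
  rw [CFC.abs, CFC.sqrt_eq_real_sqrt _ (star_mul_self_nonneg A), cfcₙ_eq_cfc,
    Matrix.star_eq_conjTranspose, trace_cfc (Matrix.isHermitian_conjTranspose_mul_self A)]
  simp [traceNorm]

/-- The sign of a Hermitian matrix: a contraction which turns the matrix into its modulus. -/
theorem exists_sign {A : Matrix n n ℂ} (hA : A.IsHermitian) :
    ∃ Z : Matrix n n ℂ, ‖Z‖ ≤ 1 ∧ Z * A = CFC.abs A := by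
  have hc : ∀ f : ℝ → ℝ, ContinuousOn f (spectrum ℝ A) := fun f =>
    (Matrix.finite_real_spectrum (𝕜 := ℂ) (A := A)).continuousOn f
  have hA' : IsSelfAdjoint A := hA
  refine ⟨cfc (fun x : ℝ => (SignType.sign x : ℝ)) A, norm_cfc_le zero_le_one fun x _ => ?_, ?_⟩
  · rcases lt_trichotomy x 0 with h | h | h <;> simp [h]
  · rw [CFC.abs_eq_cfc_norm A]
    nth_rewrite 2 [← cfc_id ℝ A]
    rw [← cfc_mul _ _ A (hc _) (hc _)]
    refine cfc_congr fun x _ => ?_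
    simp

/-- The trace norm is bounded by testing against operators; the sign of the matrix is the extremal
one. -/
theorem traceNorm_le_of_forall {A : Matrix n n ℂ} (hA : A.IsHermitian) {c : ℝ} (hc : 0 ≤ c)
    (h : ∀ Z : Matrix n n ℂ, ‖(Z * A).trace‖ ≤ c * ‖Z‖) : traceNorm A ≤ c := by
  obtain ⟨Z, hZ, hZA⟩ := exists_sign hA
  have h1 := h Z
  rw [hZA, ← ofReal_traceNorm, Complex.norm_real] at h1
  exact (le_abs_self _).trans (h1.trans (mul_le_of_le_one_right hc hZ))

theorem norm_trace_mul_sub_le {X Y : Matrix n n ℂ} (hX : X.PosSemidef) (hY : Y.PosSemidef)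
    (Z : Matrix n n ℂ) : ‖(Z * (X - Y)).trace‖ ≤ ‖Z‖ * (X + Y).trace.re := by
  rw [mul_sub, Matrix.trace_sub, Matrix.trace_add, Complex.add_re, mul_add]
  exact (norm_sub_le _ _).trans (add_le_add (norm_trace_mul_le hX Z) (norm_trace_mul_le hY Z))

theorem traceNorm_sub_le {X Y : Matrix n n ℂ} (hX : X.PosSemidef) (hY : Y.PosSemidef) :
    traceNorm (X - Y) ≤ (X + Y).trace.re := by
  refine traceNorm_le_of_forall (hX.1.sub hY.1)
    (Complex.nonneg_iff.mp (hX.add hY).trace_nonneg).1 fun Z => ?_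
  rw [mul_comm]
  exact norm_trace_mul_sub_le hX hY Z

/-- Jordan decomposition into positive and negative parts, whose traces add up to the trace norm. -/
theorem exists_posSemidef_sub {A : Matrix n n ℂ} (hA : A.IsHermitian) :
    ∃ X Y : Matrix n n ℂ, X.PosSemidef ∧ Y.PosSemidef ∧ X - Y = A ∧
      (X + Y).trace = traceNorm A := by
  have hA' : IsSelfAdjoint A := hA
  refine ⟨A⁺, A⁻, Matrix.nonneg_iff_posSemidef.mp (CFC.posPart_nonneg A),
    Matrix.nonneg_iff_posSemidef.mp (CFC.negPart_nonneg A),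
    CFC.posPart_sub_negPart A, ?_⟩
  rw [CFC.posPart_add_negPart A, ofReal_traceNorm]

theorem norm_trace_mul_le_traceNorm {A : Matrix n n ℂ} (hA : A.IsHermitian) (Z : Matrix n n ℂ) :
    ‖(Z * A).trace‖ ≤ ‖Z‖ * traceNorm A := by
  obtain ⟨X, Y, hX, hY, rfl, h⟩ := exists_posSemidef_sub hA
  have := norm_trace_mul_sub_le hX hY Z
  rwa [h, Complex.ofReal_re] at this

end TraceNorm

/-! ### Distance to a self-adjoint subspace and its dual certificate -/

section Duality

variable {n : Type*} [Fintype n] [DecidableEq n]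

/-- Hermitian members of a complex subspace of matrices. -/
def hermitianPart (T : Submodule ℂ (Matrix n n ℂ)) : Set (Matrix n n ℂ) :=
  {S | S.IsHermitian ∧ S ∈ T}

theorem exists_nearest (T : Submodule ℂ (Matrix n n ℂ)) (H : Matrix n n ℂ) :
    ∃ S ∈ hermitianPart T, ∀ S' ∈ hermitianPart T, ‖H - S‖ ≤ ‖H - S'‖ := by
  have hcl : IsClosed (hermitianPart T) := by
    have h1 : IsClosed {S : Matrix n n ℂ | star S = S} :=
      isClosed_eq continuous_star continuous_id
    exact h1.inter T.closed_of_finiteDimensional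
  have : ProperSpace (Matrix n n ℂ) := FiniteDimensional.proper ℂ _
  obtain ⟨S, hS, h⟩ := hcl.exists_infDist_eq_dist ⟨0, Matrix.isHermitian_zero, T.zero_mem⟩ H
  refine ⟨S, hS, fun S' hS' => ?_⟩
  rw [← dist_eq_norm, ← dist_eq_norm, ← h]
  exact Metric.infDist_le_dist_of_mem hS'

/-- For Hermitian `H`, the distance to a self-adjoint complex subspace is already realized by its
Hermitian members. -/
theorem norm_sub_hermitian_le {H S : Matrix n n ℂ} (hH : H.IsHermitian) :
    ‖H - (1 / 2 : ℂ) • (S + S.conjTranspose)‖ ≤ ‖H - S‖ := by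
  have h : H - (1 / 2 : ℂ) • (S + S.conjTranspose)
      = (1 / 2 : ℂ) • ((H - S) + (H - S).conjTranspose) := by
    rw [Matrix.conjTranspose_sub, hH.eq]
    module
  rw [h, norm_smul]
  have := norm_add_le (H - S) (H - S).conjTranspose
  rw [Matrix.l2_opNorm_conjTranspose] at this
  rw [show ‖(1 / 2 : ℂ)‖ = 1 / 2 by norm_num]
  linarith

theorem isHermitian_half_add {m : Type*} (S : Matrix m m ℂ) :
    ((1 / 2 : ℂ) • (S + S.conjTranspose)).IsHermitian := by
  simp [Matrix.IsHermitian, Matrix.conjTranspose_smul, add_comm]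

/-- Linear functionals on matrices are given by the trace pairing. -/
theorem exists_trace_repr (f : Matrix n n ℂ →ₗ[ℂ] ℂ) :
    ∃ C : Matrix n n ℂ, ∀ A, f A = (A * C).trace := by
  refine ⟨Matrix.of fun b a => f (Matrix.single a b 1), fun A => ?_⟩
  conv_lhs => rw [Matrix.matrix_eq_sum_single A]
  simp only [map_sum, Matrix.trace, Matrix.diag, Matrix.mul_apply, Matrix.of_apply]
  refine Finset.sum_congr rfl fun i _ => Finset.sum_congr rfl fun j _ => ?_
  rw [← smul_eq_mul, ← map_smul, Matrix.smul_single, smul_eq_mul, mul_one]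

/-- Trace-norm duality: the distance of `H` to the Hermitian part of `T` is witnessed by a Hermitian
matrix of trace norm at most one which annihilates `T`. -/
theorem exists_dual_certificate (T : Submodule ℂ (Matrix n n ℂ))
    (hT : ∀ S ∈ T, S.conjTranspose ∈ T) {H S₀ : Matrix n n ℂ} (hH : H.IsHermitian)
    (hS₀ : S₀ ∈ hermitianPart T) (hmin : ∀ S ∈ hermitianPart T, ‖H - S₀‖ ≤ ‖H - S‖) :
    ∃ C : Matrix n n ℂ, C.IsHermitian ∧ traceNorm C ≤ 1 ∧ (∀ S ∈ T, (S * C).trace = 0) ∧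
      (H * C).trace = ‖H - S₀‖ := by
  obtain ⟨g, hg, hgH⟩ := exists_dual_vector'' ℂ (Submodule.Quotient.mk (p := T) H)
  -- the norm in the quotient is an infimum over all of `T`, but Hermitian members suffice
  have hnorm : ‖(Submodule.Quotient.mk (p := T) H)‖ = ‖H - S₀‖ := by
    refine le_antisymm ?_ ?_
    · have : (Submodule.Quotient.mk (p := T) H) = Submodule.Quotient.mk (H - S₀) := by
        rw [Submodule.Quotient.mk_sub, (Submodule.Quotient.mk_eq_zero T).mpr hS₀.2, sub_zero]
      rw [this]
      exact Submodule.Quotient.norm_mk_le T _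
    · refine le_of_forall_pos_le_add fun ε hε => ?_
      obtain ⟨A, hA, hlt⟩ := Submodule.Quotient.norm_mk_lt (Submodule.Quotient.mk (p := T) H) hε
      have hS : H - A ∈ T := (Submodule.Quotient.eq T).mp hA.symm
      have h2 := hmin ((1 / 2 : ℂ) • ((H - A) + (H - A).conjTranspose))
        ⟨isHermitian_half_add _, T.smul_mem _ (T.add_mem hS (hT _ hS))⟩
      have h3 := norm_sub_hermitian_le (S := H - A) hH
      rw [sub_sub_cancel] at h3
      linarith
  obtain ⟨C, hC⟩ := exists_trace_repr (g.toLinearMap ∘ₗ T.mkQ)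
  have hC' : ∀ A, g (Submodule.Quotient.mk A) = (A * C).trace := hC
  have hadj : ∀ A : Matrix n n ℂ,
      (A * C.conjTranspose).trace = star (A.conjTranspose * C).trace := fun A => by
    rw [← Matrix.trace_conjTranspose, Matrix.conjTranspose_mul, Matrix.conjTranspose_conjTranspose,
      Matrix.trace_mul_comm]
  have hexp : ∀ A : Matrix n n ℂ, (A * (1 / 2 : ℂ) • (C + C.conjTranspose)).trace
      = (1 / 2 : ℂ) * ((A * C).trace + star (A.conjTranspose * C).trace) := fun A => by
    rw [Matrix.mul_smul, Matrix.trace_smul, mul_add, Matrix.trace_add, hadj, smul_eq_mul]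
  have hb : ∀ A : Matrix n n ℂ, ‖(A * C).trace‖ ≤ ‖A‖ := fun A => by
    rw [← hC']
    refine (g.le_opNorm _).trans ?_
    exact (mul_le_of_le_one_left (norm_nonneg _) hg).trans (Submodule.Quotient.norm_mk_le T _)
  have h0 : ∀ S ∈ T, (S * C).trace = 0 := fun S hS => by
    rw [← hC', (Submodule.Quotient.mk_eq_zero T).mpr hS, map_zero]
  -- as `H` is Hermitian and `T` self-adjoint, the Hermitian part of `C` does the same job
  refine ⟨(1 / 2 : ℂ) • (C + C.conjTranspose), isHermitian_half_add C, ?_, fun S hS => ?_, ?_⟩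
  · refine traceNorm_le_of_forall (isHermitian_half_add C) zero_le_one fun A => ?_
    rw [hexp, norm_mul, one_mul]
    have h1 := hb A
    have h2 := hb A.conjTranspose
    rw [Matrix.l2_opNorm_conjTranspose] at h2
    have h3 := norm_add_le (A * C).trace (star (A.conjTranspose * C).trace)
    rw [norm_star] at h3
    rw [show ‖(1 / 2 : ℂ)‖ = 1 / 2 by norm_num]
    linarith
  · rw [hexp, h0 S hS, h0 _ (hT S hS)]
    simp
  · rw [hexp, hH.eq, ← hC', hgH, hnorm]
    simp
    ring

end Duality

/-! ### The trace-norm program and the semidefinite program -/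

section Program

variable {d d' r : ℕ}

/-- The complex span of the products `Kᵢ† Kⱼ`. -/
def krausProductSpan (K : Fin r → Matrix (Fin d') (Fin d) ℂ) :
    Submodule ℂ (Matrix (Fin d) (Fin d) ℂ) :=
  Submodule.span ℂ {A | ∃ i j, A = (K i).conjTranspose * K j}

theorem mem_krausProductSpan (K : Fin r → Matrix (Fin d') (Fin d) ℂ) (i j : Fin r) :
    (K i).conjTranspose * K j ∈ krausProductSpan K :=
  Submodule.subset_span ⟨i, j, rfl⟩

theorem one_mem_krausSpan {K : Fin r → Matrix (Fin d') (Fin d) ℂ} (hK : IsKraus K) :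
    1 ∈ krausSpan K :=
  ⟨Matrix.isHermitian_one, hK ▸ Submodule.sum_mem _ fun i _ => mem_krausProductSpan K i i⟩

theorem conjTranspose_mem_krausProductSpan (K : Fin r → Matrix (Fin d') (Fin d) ℂ)
    {S : Matrix (Fin d) (Fin d) ℂ} (hS : S ∈ krausProductSpan K) :
    S.conjTranspose ∈ krausProductSpan K := by
  induction hS using Submodule.span_induction with
  | mem x hx =>
    obtain ⟨i, j, rfl⟩ := hx
    rw [Matrix.conjTranspose_mul, Matrix.conjTranspose_conjTranspose]
    exact mem_krausProductSpan K j i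
  | zero => simp
  | add x y _ _ hx hy => rw [Matrix.conjTranspose_add]; exact Submodule.add_mem _ hx hy
  | smul c x _ hx => rw [Matrix.conjTranspose_smul]; exact Submodule.smul_mem _ _ hx

/-- A matrix orthogonal to the Kraus span is orthogonal to the products `Kᵢ† Kⱼ`, which are complex
combinations of Hermitian elements of the span. -/
theorem trace_mul_eq_zero {K : Fin r → Matrix (Fin d') (Fin d) ℂ} {C : Matrix (Fin d) (Fin d) ℂ}
    (hC : ∀ S ∈ krausSpan K, (C * S).trace = 0) {S : Matrix (Fin d) (Fin d) ℂ}
    (hS : S ∈ krausProductSpan K) : (C * S).trace = 0 := by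
  have hS' := conjTranspose_mem_krausProductSpan K hS
  have h1 := hC _ ⟨isHermitian_half_add S,
    Submodule.smul_mem _ _ (Submodule.add_mem _ hS hS')⟩
  have h2 := hC _ ⟨isHermitian_half_add (Complex.I • S), Submodule.smul_mem _ _
    (Submodule.add_mem _ (Submodule.smul_mem _ Complex.I hS)
      (conjTranspose_mem_krausProductSpan K (Submodule.smul_mem _ Complex.I hS)))⟩
  simp only [Matrix.conjTranspose_smul, Matrix.mul_smul, Matrix.mul_add, Matrix.trace_smul,
    Matrix.trace_add, smul_eq_mul, Complex.star_def, Complex.conj_I] at h1 h2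
  linear_combination h1 - Complex.I * h2 +
    (1 / 2) * ((C * S).trace - (C * S.conjTranspose).trace) * Complex.I_sq

theorem trace_mul_sub_of_orthogonal {K : Fin r → Matrix (Fin d') (Fin d) ℂ}
    {C S : Matrix (Fin d) (Fin d) ℂ} (hC : ∀ S ∈ krausSpan K, (C * S).trace = 0)
    (hS : S ∈ krausSpan K) (H : Matrix (Fin d) (Fin d) ℂ) :
    ((H - S) * C).trace = (H * C).trace := by
  rw [sub_mul, Matrix.trace_sub, Matrix.trace_mul_comm S, hC S hS, sub_zero]

/-- Weak duality. -/
theorem norm_trace_le_of_codeFeasible {K : Fin r → Matrix (Fin d') (Fin d) ℂ}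
    {C S : Matrix (Fin d) (Fin d) ℂ} (hC : C ∈ CodeFeasible K) (hS : S ∈ krausSpan K)
    (H : Matrix (Fin d) (Fin d) ℂ) : ‖(H * C).trace‖ ≤ ‖H - S‖ * traceNorm C := by
  rw [← trace_mul_sub_of_orthogonal hC.2.2 hS]
  exact norm_trace_mul_le_traceNorm hC.1 _

theorem codeFeasible_of_sdpFeasible {K : Fin r → Matrix (Fin d') (Fin d) ℂ}
    {p : Matrix (Fin d) (Fin d) ℂ × Matrix (Fin d) (Fin d) ℂ} (hp : p ∈ SDPFeasible K) :
    p.1 - p.2 ∈ CodeFeasible K := by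
  obtain ⟨h1, h2, h3, h4⟩ := hp
  refine ⟨h1.1.sub h2.1, (traceNorm_sub_le h1 h2).trans h3, fun S hS => ?_⟩
  obtain ⟨-, h⟩ := hS
  induction h using Submodule.span_induction with
  | mem x hx => obtain ⟨i, j, rfl⟩ := hx; exact h4 i j
  | zero => simp
  | add x y _ _ hx hy => rw [mul_add, Matrix.trace_add, hx, hy, add_zero]
  | smul c x _ hx => rw [Matrix.mul_smul, Matrix.trace_smul, hx, smul_zero]

/-- Strong duality: the semidefinite program reaches twice the distance of `H` to the Kraus span. -/
theorem exists_sdpFeasible_trace_eq {K : Fin r → Matrix (Fin d') (Fin d) ℂ}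
    {H S₀ : Matrix (Fin d) (Fin d) ℂ} (hH : H.IsHermitian) (hS₀ : S₀ ∈ krausSpan K)
    (hmin : ∀ S ∈ krausSpan K, ‖H - S₀‖ ≤ ‖H - S‖) :
    ∃ p ∈ SDPFeasible K, (H * (p.1 - p.2)).trace = 2 * ‖H - S₀‖ := by
  obtain ⟨C, hC, hC1, hC0, hCH⟩ := exists_dual_certificate (krausProductSpan K)
    (fun S hS => conjTranspose_mem_krausProductSpan K hS) hH hS₀ hmin
  obtain ⟨X, Y, hX, hY, rfl, hXY⟩ := exists_posSemidef_sub hC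
  refine ⟨((2 : ℝ) • X, (2 : ℝ) • Y), ⟨hX.smul zero_le_two, hY.smul zero_le_two, ?_,
    fun i j => ?_⟩, ?_⟩
  · rw [← smul_add, Matrix.trace_smul, hXY]
    simp
    linarith
  · rw [← smul_sub, Matrix.smul_mul, Matrix.trace_smul, Matrix.trace_mul_comm,
      hC0 _ (mem_krausProductSpan K i j), smul_zero]
  · rw [← smul_sub, Matrix.mul_smul, Matrix.trace_smul, hCH]
    simp

section Optimal

variable {K : ℝ → Fin r → Matrix (Fin d') (Fin d) ℂ} {ω : ℝ} {S₀ : Matrix (Fin d) (Fin d) ℂ}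
  (hH : (krausHamiltonian K ω).IsHermitian) (hS₀ : S₀ ∈ krausSpan (K ω))
  (hmin : ∀ S ∈ krausSpan (K ω), ‖krausHamiltonian K ω - S₀‖ ≤ ‖krausHamiltonian K ω - S‖)

include hS₀ in
theorem norm_trace_le_of_codeFeasible_two {C : Matrix (Fin d) (Fin d) ℂ}
    (hC : C ∈ CodeFeasible (K ω)) :
    ‖(krausHamiltonian K ω * C).trace‖ ≤ 2 * ‖krausHamiltonian K ω - S₀‖ := by
  refine (norm_trace_le_of_codeFeasible hC hS₀ _).trans ?_
  rw [mul_comm]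
  exact mul_le_mul_of_nonneg_right hC.2.1 (norm_nonneg _)

include hH hS₀ hmin in
theorem exists_isSDPOptimal : ∃ p, IsSDPOptimal K ω p := by
  obtain ⟨p, hp, hval⟩ := exists_sdpFeasible_trace_eq hH hS₀ hmin
  refine ⟨p, hp, fun q hq => ?_⟩
  have h := norm_trace_le_of_codeFeasible_two hS₀ (codeFeasible_of_sdpFeasible hq)
  rw [hval]
  refine ((Complex.re_le_norm _).trans h).trans_eq ?_
  norm_cast

include hH hS₀ hmin in
theorem isCodeOptimal_of_isSDPOptimal
    {p : Matrix (Fin d) (Fin d) ℂ × Matrix (Fin d) (Fin d) ℂ} (hp : IsSDPOptimal K ω p) :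
    IsCodeOptimal K ω (p.1 - p.2) := by
  obtain ⟨q, hq, hval⟩ := exists_sdpFeasible_trace_eq hH hS₀ hmin
  refine ⟨codeFeasible_of_sdpFeasible hp.1, fun C hC => ?_⟩
  refine (norm_trace_le_of_codeFeasible_two hS₀ hC).trans ?_
  have h := hp.2 q hq
  rw [hval] at h
  refine le_trans (le_of_eq ?_) (h.trans (Complex.re_le_norm _))
  norm_cast

include hH hS₀ hmin in
theorem norm_trace_of_isCodeOptimal {C : Matrix (Fin d) (Fin d) ℂ} (hC : IsCodeOptimal K ω C) :
    ‖(krausHamiltonian K ω * C).trace‖ = 2 * ‖krausHamiltonian K ω - S₀‖ := by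
  refine le_antisymm (norm_trace_le_of_codeFeasible_two hS₀ hC.1) ?_
  obtain ⟨q, hq, hval⟩ := exists_sdpFeasible_trace_eq hH hS₀ hmin
  have h := hC.2 _ (codeFeasible_of_sdpFeasible hq)
  rw [hval] at h
  refine le_trans (le_of_eq ?_) h
  simp

include hH hS₀ hmin in
/-- A maximizer uses up the whole trace norm and is traceless, so that its positive and negative
parts are density matrices; a factorization of each as `A A†` gives the code matrices. -/
theorem exists_code_of_isCodeOptimal (hK : IsKraus (K ω))
    (hHS : krausHamiltonian K ω ∉ krausSpan (K ω)) {C : Matrix (Fin d) (Fin d) ℂ}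
    (hC : IsCodeOptimal K ω C) :
    ∃ A₀ A₁ : Matrix (Fin d) (Fin d) ℂ,
      (A₀.conjTranspose * A₀).trace = 1 ∧ (A₁.conjTranspose * A₁).trace = 1 ∧
        A₀ * A₀.conjTranspose - A₁ * A₁.conjTranspose = C := by
  have hpos : 0 < ‖krausHamiltonian K ω - S₀‖ := by
    rw [norm_pos_iff, sub_ne_zero]
    rintro h
    exact hHS (h ▸ hS₀)
  have h2 : traceNorm C = 2 := by
    refine le_antisymm hC.1.2.1 ?_
    have h := norm_trace_le_of_codeFeasible hC.1 hS₀ (krausHamiltonian K ω)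
    rw [norm_trace_of_isCodeOptimal hH hS₀ hmin hC, mul_comm] at h
    exact le_of_mul_le_mul_left h hpos
  have htr : C.trace = 0 := by simpa using hC.1.2.2 1 (one_mem_krausSpan hK)
  obtain ⟨X, Y, hX, hY, hXY, hsum⟩ := exists_posSemidef_sub hC.1.1
  rw [h2, Matrix.trace_add] at hsum
  rw [← hXY, Matrix.trace_sub] at htr
  push_cast at hsum
  obtain ⟨A₀, hA₀⟩ := CStarAlgebra.nonneg_iff_eq_mul_star_self.mp hX.nonneg
  obtain ⟨A₁, hA₁⟩ := CStarAlgebra.nonneg_iff_eq_mul_star_self.mp hY.nonneg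
  rw [Matrix.star_eq_conjTranspose] at hA₀ hA₁
  refine ⟨A₀, A₁, ?_, ?_, by rw [← hA₀, ← hA₁, hXY]⟩
  · rw [Matrix.trace_mul_comm, ← hA₀]
    linear_combination (hsum + htr) / 2
  · rw [Matrix.trace_mul_comm, ← hA₁]
    linear_combination (hsum - htr) / 2

end Optimal
end Program

/-! ### Bounds on the Fisher information and existence of logarithmic derivatives -/

section FisherBounds

variable {n m κ : Type*} [Fintype n] [Fintype m] [Fintype κ]

theorem IsSLD.trace_mul {σ σ' L : Matrix n n ℂ} (h : IsSLD σ σ' L) :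
    (L * σ').trace = (L * L * σ).trace := by
  rw [h.2, Matrix.mul_smul, Matrix.trace_smul, mul_add, Matrix.trace_add, ← mul_assoc,
    Matrix.trace_mul_comm (L * σ) L, ← mul_assoc, smul_eq_mul]
  ring

theorem IsSLD.two_mul_trace_mul {σ σ' L : Matrix n n ℂ} (h : IsSLD σ σ' L) (X : Matrix n n ℂ) :
    2 * (X * σ').trace = (X * σ * L).trace + (L * σ * X).trace := by
  rw [h.2, Matrix.mul_smul, Matrix.trace_smul, mul_add, Matrix.trace_add, ← mul_assoc,
    Matrix.trace_mul_comm (L * σ) X, smul_eq_mul]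
  ring

/-- Variational lower bound: `L` maximizes `2 Tr (X σ') - Tr (X² σ)` over Hermitian `X`. -/
theorem IsSLD.le_trace {σ σ' L X : Matrix n n ℂ} (h : IsSLD σ σ' L) (hσ : σ.PosSemidef)
    (hX : X.IsHermitian) :
    2 * (X * σ').trace.re - (X * X * σ).trace.re ≤ (L * L * σ).trace.re := by
  have h1 := (Complex.nonneg_iff.mp (hσ.mul_mul_conjTranspose_same (L - X)).trace_nonneg).1
  rw [Matrix.conjTranspose_sub, h.1.eq, hX.eq] at h1
  have h2 : ((L - X) * σ * (L - X)).trace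
      = (L * L * σ).trace - 2 * (X * σ').trace + (X * X * σ).trace := by
    rw [h.two_mul_trace_mul, mul_assoc L L, mul_assoc X X, Matrix.trace_mul_comm L (L * σ),
      Matrix.trace_mul_comm X (X * σ), ← Matrix.trace_add, ← Matrix.trace_sub,
      ← Matrix.trace_add]
    congr 1
    noncomm_ring
  rw [h2] at h1
  simp only [Complex.add_re, Complex.sub_re, Complex.mul_re, Complex.re_ofNat, Complex.im_ofNat,
    zero_mul, sub_zero] at h1
  linarith

/-- Upper bound for the Fisher information of a channel output in terms of any operators `E s`
which generate the velocity of the output together with the Kraus operators `M s`. -/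
theorem IsSLD.trace_le {σ σ' L : Matrix m m ℂ} (h : IsSLD σ σ' L) {ρ : Matrix n n ℂ}
    (hρ : ρ.PosSemidef) {M E : κ → Matrix m n ℂ}
    (hσ : σ = ∑ s, M s * ρ * (M s).conjTranspose)
    (hσ' : σ' = ∑ s, (E s * ρ * (M s).conjTranspose + M s * ρ * (E s).conjTranspose)) :
    (L * L * σ).trace.re ≤ 4 * ((∑ s, (E s).conjTranspose * E s) * ρ).trace.re := by
  have h1 : ∀ s, 0 ≤ ((L * M s - (2 : ℂ) • E s) * ρ *
      (L * M s - (2 : ℂ) • E s).conjTranspose).trace.re := fun s =>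
    (Complex.nonneg_iff.mp (hρ.mul_mul_conjTranspose_same _).trace_nonneg).1
  have h2 : ∀ s, ((L * M s - (2 : ℂ) • E s) * ρ *
      (L * M s - (2 : ℂ) • E s).conjTranspose).trace =
      (L * L * (M s * ρ * (M s).conjTranspose)).trace
      - 2 * (L * (E s * ρ * (M s).conjTranspose + M s * ρ * (E s).conjTranspose)).trace
      + 4 * ((E s).conjTranspose * E s * ρ).trace := by
    intro s
    have e1 : (L * L * (M s * ρ * (M s).conjTranspose)).trace
        = (L * (M s * ρ * (M s).conjTranspose) * L).trace := by
      rw [mul_assoc, Matrix.trace_mul_comm]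
    have e2 : (L * (E s * ρ * (M s).conjTranspose)).trace
        = ((E s * ρ * (M s).conjTranspose) * L).trace := Matrix.trace_mul_comm _ _
    have e3 : ((E s).conjTranspose * E s * ρ).trace
        = (E s * ρ * (E s).conjTranspose).trace := by
      rw [Matrix.mul_assoc, Matrix.trace_mul_comm]
    rw [e1, mul_add, Matrix.trace_add, e2, e3]
    simp only [Matrix.conjTranspose_sub, Matrix.conjTranspose_mul, h.1.eq,
      Matrix.conjTranspose_smul, Matrix.sub_mul, Matrix.mul_sub, Matrix.smul_mul, Matrix.mul_smul,
      Matrix.trace_sub, Matrix.trace_smul, smul_eq_mul, Matrix.mul_assoc, star_ofNat]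
    ring
  have h3 : (L * L * σ).trace - 2 * (L * σ').trace
      + 4 * ((∑ s, (E s).conjTranspose * E s) * ρ).trace
      = ∑ s, ((L * M s - (2 : ℂ) • E s) * ρ *
      (L * M s - (2 : ℂ) • E s).conjTranspose).trace := by
    simp only [h2]
    rw [Finset.sum_add_distrib, Finset.sum_sub_distrib, ← Finset.mul_sum, ← Finset.mul_sum,
      ← Matrix.trace_sum, ← Matrix.trace_sum, ← Matrix.trace_sum, ← Finset.mul_sum,
      ← Finset.mul_sum, ← Matrix.sum_mul, hσ, hσ']
  have h4 := Finset.sum_nonneg fun s (_ : s ∈ Finset.univ) => h1 s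
  rw [← Complex.re_sum, ← h3, h.trace_mul] at h4
  simp only [Complex.add_re, Complex.sub_re, Complex.mul_re, Complex.re_ofNat, Complex.im_ofNat,
    zero_mul, sub_zero] at h4
  linarith

/-- A symmetric logarithmic derivative exists if the velocity has no matrix elements between
vectors of the kernel of the state. -/
theorem exists_isSLD [DecidableEq n] {σ σ' : Matrix n n ℂ} (hσ : σ.PosSemidef)
    (hσ' : σ'.IsHermitian)
    (hker : ∀ v w, σ.mulVec v = 0 → σ.mulVec w = 0 → star v ⬝ᵥ σ'.mulVec w = 0) :
    ∃ L, IsSLD σ σ' L := by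
  set p := hσ.1.eigenvalues with hp
  set U : Matrix n n ℂ := (hσ.1.eigenvectorUnitary : Matrix n n ℂ) with hU
  have hU1 : U * U.conjTranspose = 1 := Unitary.mul_star_self_of_mem hσ.1.eigenvectorUnitary.2
  have hU2 : U.conjTranspose * U = 1 := Unitary.star_mul_self_of_mem hσ.1.eigenvectorUnitary.2
  set D : Matrix n n ℂ := Matrix.diagonal fun i => (p i : ℂ) with hD
  have hspec : σ = U * D * U.conjTranspose := by
    conv_lhs => rw [hσ.1.spectral_theorem]
    rw [Unitary.conjStarAlgAut_apply]
    rfl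
  have hp0 : ∀ i, 0 ≤ p i := hσ.eigenvalues_nonneg
  set G := U.conjTranspose * σ' * U with hG
  have hGh : G.IsHermitian := Matrix.isHermitian_conjTranspose_mul_mul U hσ'
  have hk : ∀ i, p i = 0 → σ.mulVec (U.mulVec (Pi.single i 1)) = 0 := by
    intro i hi
    rw [Matrix.mulVec_mulVec, hspec, mul_assoc, hU2, mul_one, ← Matrix.mulVec_mulVec]
    have : D.mulVec (Pi.single i 1) = 0 := by
      ext j
      simp only [hD, Matrix.mulVec_diagonal, Pi.zero_apply]
      by_cases hj : j = i
      · subst hj; simp [hi]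
      · simp [hj]
    rw [this, Matrix.mulVec_zero]
  have hG0 : ∀ i j, p i + p j = 0 → G i j = 0 := by
    intro i j hij
    have hi : p i = 0 := by linarith [hp0 i, hp0 j]
    have hj : p j = 0 := by linarith [hp0 i, hp0 j]
    have h := hker _ _ (hk i hi) (hk j hj)
    rw [Matrix.star_mulVec, Matrix.mulVec_mulVec, ← Matrix.dotProduct_mulVec,
      Matrix.mulVec_mulVec, ← mul_assoc, ← hG] at h
    simpa [← Pi.single_star] using h
  -- solve entrywise in the eigenbasis: where `p i + p j = 0`, the division gives `0`, as does `G i j`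
  refine ⟨U * (Matrix.of fun i j => 2 * G i j / (p i + p j : ℝ)) * U.conjTranspose, ?_, ?_⟩
  · refine Matrix.isHermitian_mul_mul_conjTranspose U ?_
    ext i j
    have := congrFun (congrFun hGh i) j
    rw [Matrix.conjTranspose_apply] at this
    simp only [Matrix.conjTranspose_apply, Matrix.of_apply, star_div₀, star_mul', this,
      star_ofNat, Complex.star_def, Complex.conj_ofReal]
    rw [add_comm]
  · set M : Matrix n n ℂ := Matrix.of fun i j => 2 * G i j / (p i + p j : ℝ) with hM
    have hDM : D * M + M * D = (2 : ℂ) • G := by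
      ext i j
      simp only [hD, Matrix.add_apply, Matrix.diagonal_mul, Matrix.mul_diagonal, hM,
        Matrix.of_apply, Matrix.smul_apply, smul_eq_mul]
      by_cases hij : p i + p j = 0
      · simp [hG0 i j hij]
      · have : ((p i + p j : ℝ) : ℂ) ≠ 0 := by exact_mod_cast hij
        field_simp
        push_cast
        ring
    have h1 : σ * (U * M * U.conjTranspose) + U * M * U.conjTranspose * σ
        = U * (D * M + M * D) * U.conjTranspose := by
      have e1 : σ * (U * M * U.conjTranspose)
          = U * D * (U.conjTranspose * U) * M * U.conjTranspose := by
        rw [hspec]; simp only [mul_assoc]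
      have e2 : U * M * U.conjTranspose * σ
          = U * M * (U.conjTranspose * U) * D * U.conjTranspose := by
        rw [hspec]; simp only [mul_assoc]
      rw [e1, e2, hU2, mul_one, mul_one, mul_add, add_mul, mul_assoc U D, mul_assoc U M]
    have h2 : U * G * U.conjTranspose = σ' := by
      calc U * G * U.conjTranspose
          = (U * U.conjTranspose) * σ' * (U * U.conjTranspose) := by
            rw [hG]; simp only [mul_assoc]
        _ = σ' := by rw [hU1, one_mul, mul_one]
    rw [h1, hDM, Matrix.mul_smul, Matrix.smul_mul, h2, smul_smul]
    norm_num

/-- Outputs of differentiable channels have symmetric logarithmic derivatives. -/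
theorem exists_isSLD_of_kraus {ρ : Matrix n n ℂ} (hρ : ρ.PosSemidef) [DecidableEq m]
    (M E : κ → Matrix m n ℂ) :
    ∃ L, IsSLD (∑ s, M s * ρ * (M s).conjTranspose)
      (∑ s, (E s * ρ * (M s).conjTranspose + M s * ρ * (E s).conjTranspose)) L := by
  have hpsd : ∀ s, (M s * ρ * (M s).conjTranspose).PosSemidef := fun s =>
    hρ.mul_mul_conjTranspose_same _
  have hsum : (∑ s, M s * ρ * (M s).conjTranspose).PosSemidef :=
    Matrix.posSemidef_sum _ fun s _ => hpsd s
  have hk : ∀ w, (∑ s, M s * ρ * (M s).conjTranspose).mulVec w = 0 →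
      ∀ s, ρ.mulVec ((M s).conjTranspose.mulVec w) = 0 := by
    intro w hw s
    have h1 : ∑ s, star w ⬝ᵥ (M s * ρ * (M s).conjTranspose).mulVec w = 0 := by
      rw [← dotProduct_sum, ← Matrix.sum_mulVec, hw, dotProduct_zero]
    have h2 := (Finset.sum_eq_zero_iff_of_nonneg
      fun s _ => (hpsd s).dotProduct_mulVec_nonneg w).mp h1 s (Finset.mem_univ s)
    rw [← hρ.dotProduct_mulVec_zero_iff, ← h2, Matrix.star_mulVec,
      Matrix.conjTranspose_conjTranspose, ← Matrix.dotProduct_mulVec, Matrix.mulVec_mulVec,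
      Matrix.mulVec_mulVec, Matrix.mul_assoc]
  refine exists_isSLD hsum ?_ fun v w hv hw => ?_
  · rw [Matrix.IsHermitian, Matrix.conjTranspose_sum]
    refine Finset.sum_congr rfl fun s _ => ?_
    simp only [Matrix.conjTranspose_add, Matrix.conjTranspose_mul,
      Matrix.conjTranspose_conjTranspose, hρ.1.eq, Matrix.mul_assoc]
    rw [add_comm]
  · rw [Matrix.sum_mulVec, dotProduct_sum]
    refine Finset.sum_eq_zero fun s _ => ?_
    have e1 : (E s * ρ * (M s).conjTranspose).mulVec w = 0 := by
      rw [Matrix.mul_assoc, ← Matrix.mulVec_mulVec, ← Matrix.mulVec_mulVec, hk w hw s,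
        Matrix.mulVec_zero]
    have e2 : Matrix.vecMul (star v) (M s * ρ * (E s).conjTranspose) = 0 := by
      have := congrArg star (hk v hv s)
      rw [Matrix.mulVec_mulVec, Matrix.star_mulVec, Matrix.conjTranspose_mul, hρ.1.eq,
        Matrix.conjTranspose_conjTranspose, star_zero] at this
      rw [← Matrix.vecMul_vecMul, this, Matrix.zero_vecMul]
    rw [Matrix.add_mulVec, e1, zero_add, Matrix.dotProduct_mulVec, e2, zero_dotProduct]

end FisherBounds

/-! ### Derivatives of curves of matrices and tensor products -/

section Derivatives

variable {l m n : Type*}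

/-- `A'` is the entrywise derivative at `ω` of the curve of matrices `A`. -/
def HasMatDeriv (A : ℝ → Matrix m n ℂ) (A' : Matrix m n ℂ) (ω : ℝ) : Prop :=
  ∀ a b, HasDerivAt (fun t => A t a b) (A' a b) ω

theorem HasMatDeriv.matDeriv_eq {A : ℝ → Matrix m n ℂ} {A' : Matrix m n ℂ} {ω : ℝ}
    (h : HasMatDeriv A A' ω) : matDeriv A ω = A' := by
  ext a b
  exact (h a b).deriv

theorem hasMatDeriv_matDeriv {A : ℝ → Matrix m n ℂ} {ω : ℝ}
    (h : ∀ a b, DifferentiableAt ℝ (fun t => A t a b) ω) : HasMatDeriv A (matDeriv A ω) ω :=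
  fun a b => (h a b).hasDerivAt

theorem hasMatDeriv_const (A : Matrix m n ℂ) (ω : ℝ) : HasMatDeriv (fun _ => A) 0 ω :=
  fun _ _ => hasDerivAt_const _ _

theorem HasMatDeriv.sum {κ : Type*} [Fintype κ] {A : κ → ℝ → Matrix m n ℂ}
    {A' : κ → Matrix m n ℂ} {ω : ℝ} (h : ∀ s, HasMatDeriv (A s) (A' s) ω) :
    HasMatDeriv (fun t => ∑ s, A s t) (∑ s, A' s) ω := by
  intro a b
  simp only [Matrix.sum_apply]
  exact HasDerivAt.fun_sum fun s _ => h s a b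

theorem HasMatDeriv.mul [Fintype m] {A : ℝ → Matrix l m ℂ} {A' : Matrix l m ℂ}
    {B : ℝ → Matrix m n ℂ} {B' : Matrix m n ℂ} {ω : ℝ} (hA : HasMatDeriv A A' ω)
    (hB : HasMatDeriv B B' ω) :
    HasMatDeriv (fun t => A t * B t) (A' * B ω + A ω * B') ω := by
  intro a b
  simp only [Matrix.mul_apply, Matrix.add_apply, ← Finset.sum_add_distrib]
  exact HasDerivAt.fun_sum fun s _ => (hA a s).mul (hB s b)

theorem HasMatDeriv.conjTranspose {A : ℝ → Matrix m n ℂ} {A' : Matrix m n ℂ} {ω : ℝ}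
    (h : HasMatDeriv A A' ω) :
    HasMatDeriv (fun t => (A t).conjTranspose) A'.conjTranspose ω := by
  intro a b
  simp only [Matrix.conjTranspose_apply]
  exact (h b a).star

theorem HasMatDeriv.kronecker_one {a : Type*} [DecidableEq a] {A : ℝ → Matrix m n ℂ}
    {A' : Matrix m n ℂ} {ω : ℝ} (h : HasMatDeriv A A' ω) :
    HasMatDeriv (fun t => A t ⊗ₖ (1 : Matrix a a ℂ)) (A' ⊗ₖ (1 : Matrix a a ℂ)) ω := by
  intro x y
  exact (h x.1 y.1).mul_const _

theorem HasMatDeriv.sum_mul_mul_conjTranspose {κ : Type*} [Fintype κ] [Fintype n]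
    {M : κ → ℝ → Matrix m n ℂ} {E : κ → Matrix m n ℂ} {ω : ℝ} (h : ∀ s, HasMatDeriv (M s) (E s) ω)
    (ρ : Matrix n n ℂ) :
    HasMatDeriv (fun t => ∑ s, M s t * ρ * (M s t).conjTranspose)
      (∑ s, (E s * ρ * (M s ω).conjTranspose + M s ω * ρ * (E s).conjTranspose)) ω := by
  refine HasMatDeriv.sum fun s => ?_
  have h1 := ((h s).mul (hasMatDeriv_const ρ ω)).mul (h s).conjTranspose
  simpa using h1

end Derivatives

section Tensor

variable {m n l ι : Type*} {N : ℕ}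

/-- The tensor product `A₁ ⊗ ⋯ ⊗ A_N`. -/
def tensorProd (A : Fin N → Matrix m n ℂ) : Matrix (Fin N → m) (Fin N → n) ℂ :=
  Matrix.of fun x y => ∏ k, A k (x k) (y k)

theorem tensorProd_mul [Fintype n] (A : Fin N → Matrix m n ℂ) (B : Fin N → Matrix n l ℂ) :
    tensorProd A * tensorProd B = tensorProd fun k => A k * B k := by
  classical
  ext x y
  simp only [tensorProd, Matrix.mul_apply, Matrix.of_apply, ← Finset.prod_mul_distrib]
  rw [Finset.prod_univ_sum, Fintype.piFinset_univ]

theorem conjTranspose_tensorProd (A : Fin N → Matrix m n ℂ) :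
    (tensorProd A).conjTranspose = tensorProd fun k => (A k).conjTranspose := by
  ext x y
  simp [tensorProd, Matrix.conjTranspose_apply]

theorem tensorProd_one [DecidableEq m] :
    tensorProd (fun _ : Fin N => (1 : Matrix m m ℂ)) = 1 := by
  ext x y
  simp only [tensorProd, Matrix.of_apply, Matrix.one_apply]
  rw [Finset.prod_ite_zero]
  simp [funext_iff]

theorem sum_tensorProd [Fintype ι] (f : Fin N → ι → Matrix m n ℂ) :
    ∑ s : Fin N → ι, tensorProd (fun k => f k (s k)) = tensorProd fun k => ∑ j, f k j := by
  classical
  ext x y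
  simp only [tensorProd, Matrix.sum_apply, Matrix.of_apply]
  rw [Finset.prod_univ_sum, Fintype.piFinset_univ]

theorem tensorProd_ite_apply (k : Fin N) (A : Matrix m n ℂ) (B : Fin N → Matrix m n ℂ)
    (x : Fin N → m) (y : Fin N → n) :
    tensorProd (fun i => if i = k then A else B i) x y
      = A (x k) (y k) * ∏ i ∈ Finset.univ.erase k, B i (x i) (y i) := by
  rw [tensorProd, Matrix.of_apply, ← Finset.mul_prod_erase _ _ (Finset.mem_univ k), if_pos rfl]
  congr 1
  refine Finset.prod_congr rfl fun i hi => ?_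
  rw [if_neg (Finset.ne_of_mem_erase hi)]

/-- The embedding of the operators on one of `N` tensor factors. -/
def siteHom [Fintype m] [DecidableEq m] (k : Fin N) :
    Matrix m m ℂ →⋆ₙₐ[ℂ] Matrix (Fin N → m) (Fin N → m) ℂ where
  toFun A := tensorProd fun i => if i = k then A else 1
  map_smul' c A := by
    ext x y
    simp [tensorProd_ite_apply, mul_assoc]
  map_zero' := by
    ext x y
    simp [tensorProd_ite_apply]
  map_add' A B := by
    ext x y
    simp [tensorProd_ite_apply, add_mul]
  map_mul' A B := by
    rw [tensorProd_mul]
    congr 1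
    ext1 i
    split_ifs <;> simp
  map_star' A := by
    rw [Matrix.star_eq_conjTranspose, Matrix.star_eq_conjTranspose, conjTranspose_tensorProd]
    congr 1
    ext1 i
    split_ifs <;> simp

theorem siteHom_apply [Fintype m] [DecidableEq m] (k : Fin N) (A : Matrix m m ℂ) :
    siteHom k A = tensorProd fun i => if i = k then A else 1 := rfl

/-- The product of Kraus operators `K (s i)` in which the `k`-th factor is replaced by `D (s k)`. -/
def tensorReplace (K D : ι → Matrix m n ℂ) (k : Fin N) (s : Fin N → ι) :
    Matrix (Fin N → m) (Fin N → n) ℂ :=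
  tensorProd fun i => if i = k then D (s i) else K (s i)

theorem tensorReplace_eq (K D : ι → Matrix m n ℂ) (k : Fin N) (s : Fin N → ι) :
    tensorReplace K D k s = tensorProd fun i => if i = k then D (s k) else K (s i) := by
  rw [tensorReplace]
  congr 1
  ext1 i
  split_ifs with h
  · rw [h]
  · rfl

theorem tensorPow_eq (K : ι → Matrix m n ℂ) (s : Fin N → ι) :
    tensorPow N K s = tensorProd fun k => K (s k) := rfl

/-- Leibniz rule for tensor powers. -/
theorem hasMatDeriv_tensorPow {K : ℝ → ι → Matrix m n ℂ} {D : ι → Matrix m n ℂ} {ω : ℝ}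
    (h : ∀ j, HasMatDeriv (fun t => K t j) (D j) ω) (s : Fin N → ι) :
    HasMatDeriv (fun t => tensorPow N (K t) s) (∑ k, tensorReplace (K ω) D k s) ω := by
  intro x y
  have h1 := HasDerivAt.fun_finsetProd (u := Finset.univ)
    fun k (_ : k ∈ (Finset.univ : Finset (Fin N))) => h (s k) (x k) (y k)
  simp only [Matrix.sum_apply, tensorReplace_eq, tensorProd_ite_apply]
  convert! h1 using 1
  refine Finset.sum_congr rfl fun k _ => ?_
  rw [smul_eq_mul, mul_comm]

variable [Fintype m] [Fintype n] [DecidableEq n] [Fintype ι]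

theorem sum_tensorPow_conjTranspose_mul_tensorReplace {K : ι → Matrix m n ℂ} (hK : IsKraus K)
    (D : ι → Matrix m n ℂ) (k : Fin N) :
    ∑ s, (tensorPow N K s).conjTranspose * tensorReplace K D k s
      = siteHom k (∑ j, (K j).conjTranspose * D j) := by
  simp only [tensorReplace, tensorPow_eq, conjTranspose_tensorProd, tensorProd_mul]
  rw [sum_tensorProd fun i j => (K j).conjTranspose * if i = k then D j else K j, siteHom_apply]
  congr 1
  ext1 i
  split_ifs
  · rfl
  · exact hK

/-- Normalization of the Kraus operators removes all sites other than `k` and `l` from the second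
moments of the velocity. -/
theorem sum_tensorReplace_conjTranspose_mul {K : ι → Matrix m n ℂ} (hK : IsKraus K)
    (D : ι → Matrix m n ℂ) (k l : Fin N) :
    ∑ s, (tensorReplace K D k s).conjTranspose * tensorReplace K D l s
      = if k = l then siteHom k (∑ j, (D j).conjTranspose * D j)
        else siteHom k (∑ j, (K j).conjTranspose * D j).conjTranspose *
          siteHom l (∑ j, (K j).conjTranspose * D j) := by
  simp only [tensorReplace, conjTranspose_tensorProd, tensorProd_mul, siteHom_apply]
  rw [sum_tensorProd fun i j => (if i = k then D j else K j).conjTranspose *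
    if i = l then D j else K j]
  split_ifs with h
  · subst h
    congr 1
    ext1 i
    split_ifs
    · rfl
    · exact hK
  · congr 1
    ext1 i
    by_cases hk : i = k
    · have hl : i ≠ l := fun hl => h (hk.symm.trans hl)
      simp [hk, h, Matrix.conjTranspose_sum]
    · by_cases hl : i = l
      · simp [hl, Ne.symm h]
      · simp only [if_neg hk, if_neg hl, one_mul]
        exact hK

omit [Fintype n] in
theorem isKraus_tensorPow {K : ι → Matrix m n ℂ} (hK : IsKraus K) :
    IsKraus (tensorPow N K) := by
  rw [IsKraus]
  simp only [tensorPow_eq, conjTranspose_tensorProd, tensorProd_mul]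
  rw [sum_tensorProd fun _ j => (K j).conjTranspose * K j, ← tensorProd_one]
  congr 1
  ext1 i
  exact hK

theorem norm_siteHom_le (k : Fin N) (A : Matrix n n ℂ) : ‖siteHom k A‖ ≤ ‖A‖ :=
  NonUnitalStarAlgHom.norm_apply_le (siteHom k) A

/-- The collective second moment of a velocity grows quadratically in `N` only through
`∑ⱼ Kⱼ† Dⱼ`. -/
theorem norm_sum_tensorReplace_le {K : ι → Matrix m n ℂ} (hK : IsKraus K)
    (D : ι → Matrix m n ℂ) :
    ‖∑ s : Fin N → ι, (∑ k, tensorReplace K D k s).conjTranspose * ∑ k, tensorReplace K D k s‖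
      ≤ N * ‖∑ j, (D j).conjTranspose * D j‖ + N ^ 2 * ‖∑ j, (K j).conjTranspose * D j‖ ^ 2 := by
  have h1 : ∑ s : Fin N → ι, (∑ k, tensorReplace K D k s).conjTranspose *
      ∑ k, tensorReplace K D k s = ∑ k : Fin N, ∑ l : Fin N,
        ∑ s, (tensorReplace K D k s).conjTranspose * tensorReplace K D l s := by
    simp only [Matrix.conjTranspose_sum, Matrix.sum_mul, Matrix.mul_sum]
    rw [Finset.sum_comm, Finset.sum_congr rfl fun k _ => Finset.sum_comm]
    exact Finset.sum_comm
  rw [h1]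
  have h2 : ∀ k l : Fin N,
      ‖∑ s, (tensorReplace K D k s).conjTranspose * tensorReplace K D l s‖
      ≤ (if k = l then ‖∑ j, (D j).conjTranspose * D j‖ else 0)
        + ‖∑ j, (K j).conjTranspose * D j‖ ^ 2 := by
    intro k l
    rw [sum_tensorReplace_conjTranspose_mul hK]
    split_ifs
    · exact (norm_siteHom_le _ _).trans (le_add_of_nonneg_right (sq_nonneg _))
    · rw [zero_add, sq]
      refine (norm_mul_le _ _).trans (mul_le_mul ?_ (norm_siteHom_le _ _) (norm_nonneg _)
        (norm_nonneg _))
      exact (norm_siteHom_le _ _).trans_eq (Matrix.l2_opNorm_conjTranspose _)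
  calc _ ≤ ∑ k : Fin N, ∑ l : Fin N, ((if k = l then ‖∑ j, (D j).conjTranspose * D j‖ else 0)
        + ‖∑ j, (K j).conjTranspose * D j‖ ^ 2) :=
        (norm_sum_le _ _).trans (Finset.sum_le_sum fun k _ =>
          (norm_sum_le _ _).trans (Finset.sum_le_sum fun l _ => h2 k l))
    _ = _ := by
      simp [Finset.sum_add_distrib]
      ring

end Tensor

/-! ### Outputs of parallel channels -/

section Output

variable {m n a ι : Type*} {N : ℕ}

/-- The embedding `A ↦ A ⊗ 𝟙` of the probe operators. -/
def kroneckerOneHom (n a : Type*) [Fintype n] [DecidableEq n] [Fintype a] [DecidableEq a] :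
    Matrix n n ℂ →⋆ₙₐ[ℂ] Matrix (n × a) (n × a) ℂ where
  toFun A := A ⊗ₖ (1 : Matrix a a ℂ)
  map_smul' c A := Matrix.smul_kronecker c A 1
  map_zero' := Matrix.zero_kronecker 1
  map_add' A B := Matrix.add_kronecker A B 1
  map_mul' A B := by rw [← Matrix.mul_kronecker_mul, one_mul]
  map_star' A := by
    rw [Matrix.star_eq_conjTranspose, Matrix.star_eq_conjTranspose,
      Matrix.conjTranspose_kronecker, Matrix.conjTranspose_one]

theorem sum_kronecker {κ : Type*} (t : Finset κ) (f : κ → Matrix m n ℂ) (B : Matrix a a ℂ) :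
    (∑ s ∈ t, f s) ⊗ₖ B = ∑ s ∈ t, f s ⊗ₖ B := by
  ext x y
  simp [Matrix.sum_apply, Finset.sum_mul]

theorem kronecker_one_conjTranspose_mul [Fintype m] [Fintype a] [DecidableEq a]
    (A B : Matrix m n ℂ) :
    (A ⊗ₖ (1 : Matrix a a ℂ)).conjTranspose * (B ⊗ₖ (1 : Matrix a a ℂ))
      = (A.conjTranspose * B) ⊗ₖ (1 : Matrix a a ℂ) := by
  rw [Matrix.conjTranspose_kronecker, Matrix.conjTranspose_one, ← Matrix.mul_kronecker_mul,
    one_mul]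

variable [Fintype n] [Fintype ι] [Fintype a] [DecidableEq a]

/-- The velocity of the output of `N` parallel channels with Kraus operators `K j` which move with
velocities `D j`. -/
def outputVelocity (K D : ι → Matrix m n ℂ) (ρ : Matrix ((Fin N → n) × a) ((Fin N → n) × a) ℂ) :
    Matrix ((Fin N → m) × a) ((Fin N → m) × a) ℂ :=
  ∑ s : Fin N → ι,
    (((∑ k, tensorReplace K D k s) ⊗ₖ (1 : Matrix a a ℂ)) * ρ *
        (tensorPow N K s ⊗ₖ (1 : Matrix a a ℂ)).conjTranspose
      + (tensorPow N K s ⊗ₖ (1 : Matrix a a ℂ)) * ρ *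
        ((∑ k, tensorReplace K D k s) ⊗ₖ (1 : Matrix a a ℂ)).conjTranspose)

theorem hasMatDeriv_output {K : ℝ → ι → Matrix m n ℂ} {D : ι → Matrix m n ℂ} {ω : ℝ}
    (h : ∀ j, HasMatDeriv (fun t => K t j) (D j) ω)
    (ρ : Matrix ((Fin N → n) × a) ((Fin N → n) × a) ℂ) :
    HasMatDeriv (fun t => applyChannel (tensorPow N (K t)) ρ) (outputVelocity (K ω) D ρ) ω :=
  HasMatDeriv.sum_mul_mul_conjTranspose
    (fun s => (hasMatDeriv_tensorPow h s).kronecker_one (a := a)) ρ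

omit [Fintype n] in
theorem tensorReplace_sub_sum [DecidableEq ι] (K D : ι → Matrix m n ℂ) (h : Matrix ι ι ℂ)
    (k : Fin N) (s : Fin N → ι) :
    tensorReplace K (fun j => D j - Complex.I • ∑ l, h j l • K l) k s
      = tensorReplace K D k s
        - Complex.I • ∑ l, h (s k) l • tensorPow N K (Function.update s k l) := by
  have h1 : ∀ l, tensorPow N K (Function.update s k l)
      = tensorProd fun i => if i = k then K l else K (s i) := by
    intro l
    rw [tensorPow_eq]
    congr 1
    ext1 i
    by_cases hi : i = k
    · subst hi; simp
    · simp [hi]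
  ext x y
  simp only [h1, tensorReplace_eq, Matrix.sub_apply, Matrix.smul_apply, Matrix.sum_apply,
    tensorProd_ite_apply, smul_eq_mul, sub_mul, Finset.sum_mul, mul_assoc]

/-- Exchange of a multi-index with one which differs from it in the `k`-th entry. -/
theorem sum_update_swap [DecidableEq ι] {β : Type*} [AddCommMonoid β] (k : Fin N)
    (f : (Fin N → ι) → ι → (Fin N → ι) → β) :
    ∑ s, ∑ l, f s l (Function.update s k l)
      = ∑ s, ∑ l, f (Function.update s k l) (s k) s := by
  rw [← Fintype.sum_prod_type', ← Fintype.sum_prod_type'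
    (f := fun s l => f (Function.update s k l) (s k) s)]
  have hinv : Function.Involutive
      (fun p : (Fin N → ι) × ι => (Function.update p.1 k p.2, p.1 k)) := fun p => by simp
  exact (Equiv.sum_comp hinv.toPerm
    fun p : (Fin N → ι) × ι => f p.1 p.2 (Function.update p.1 k p.2)).symm.trans <| by
      refine Finset.sum_congr rfl fun p _ => ?_
      simp

/-- The velocity of the output does not see the Hermitian gauge freedom of the Kraus operators. -/
theorem outputVelocity_gauge [DecidableEq ι] (K D : ι → Matrix m n ℂ) {h : Matrix ι ι ℂ}
    (hh : h.IsHermitian) (ρ : Matrix ((Fin N → n) × a) ((Fin N → n) × a) ℂ) :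
    outputVelocity K (fun j => D j - Complex.I • ∑ l, h j l • K l) ρ = outputVelocity K D ρ := by
  set M : (Fin N → ι) → Matrix ((Fin N → m) × a) ((Fin N → n) × a) ℂ :=
    fun s => tensorPow N K s ⊗ₖ (1 : Matrix a a ℂ) with hM
  have hE : ∀ s, (∑ k, tensorReplace K (fun j => D j - Complex.I • ∑ l, h j l • K l) k s) ⊗ₖ
      (1 : Matrix a a ℂ) = (∑ k, tensorReplace K D k s) ⊗ₖ (1 : Matrix a a ℂ)
        - Complex.I • ∑ k, ∑ l, h (s k) l • M (Function.update s k l) := by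
    intro s
    simp only [tensorReplace_sub_sum]
    simp only [hM, sum_kronecker, Finset.smul_sum]
    rw [← Finset.sum_sub_distrib]
    refine Finset.sum_congr rfl fun k _ => ?_
    ext x y
    simp [Matrix.sum_apply, Finset.sum_mul, sub_mul, mul_assoc]
  -- the two gauge terms agree after exchanging the multi-indices, as `h` is Hermitian
  have key : ∑ s, (∑ k, ∑ l, h (s k) l • M (Function.update s k l)) * ρ * (M s).conjTranspose
      = ∑ s, M s * ρ * (∑ k, ∑ l, h (s k) l • M (Function.update s k l)).conjTranspose := by
    simp only [Matrix.conjTranspose_sum, Matrix.sum_mul, Matrix.mul_sum,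
      Matrix.conjTranspose_smul, Matrix.smul_mul, Matrix.mul_smul]
    rw [Finset.sum_comm, Finset.sum_comm (s := Finset.univ (α := Fin N → ι))]
    refine Finset.sum_congr rfl fun k _ => ?_
    rw [sum_update_swap k fun s l s' => h (s k) l • (M s' * ρ * (M s).conjTranspose)]
    refine Finset.sum_congr rfl fun s _ => Finset.sum_congr rfl fun l _ => ?_
    rw [Function.update_self, ← hh.apply l (s k)]
  rw [outputVelocity, outputVelocity, ← sub_eq_zero, ← Finset.sum_sub_distrib]
  simp only [hE]
  have : ∀ s, (((∑ k, tensorReplace K D k s) ⊗ₖ (1 : Matrix a a ℂ)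
        - Complex.I • ∑ k, ∑ l, h (s k) l • M (Function.update s k l)) * ρ * (M s).conjTranspose
      + M s * ρ * ((∑ k, tensorReplace K D k s) ⊗ₖ (1 : Matrix a a ℂ)
        - Complex.I • ∑ k, ∑ l, h (s k) l • M (Function.update s k l)).conjTranspose
      - (((∑ k, tensorReplace K D k s) ⊗ₖ (1 : Matrix a a ℂ)) * ρ * (M s).conjTranspose
      + M s * ρ * ((∑ k, tensorReplace K D k s) ⊗ₖ (1 : Matrix a a ℂ)).conjTranspose))
      = Complex.I • (M s * ρ *
          (∑ k, ∑ l, h (s k) l • M (Function.update s k l)).conjTranspose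
        - (∑ k, ∑ l, h (s k) l • M (Function.update s k l)) * ρ * (M s).conjTranspose) := by
    intro s
    simp only [Matrix.conjTranspose_sub, Matrix.sub_mul, Matrix.mul_sub, Matrix.smul_mul,
      Matrix.mul_smul, Matrix.conjTranspose_smul, Complex.star_def, Complex.conj_I]
    module
  rw [Finset.sum_congr rfl fun s _ => this s, ← Finset.smul_sum, Finset.sum_sub_distrib, key,
    sub_self, smul_zero]

/-- The quantum Fisher information of a parallel output is computed by a symmetric logarithmic
derivative. -/
theorem exists_isSLD_output [Fintype m] [DecidableEq m] {K : ℝ → ι → Matrix m n ℂ}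
    {D : ι → Matrix m n ℂ} {ω : ℝ} (h : ∀ j, HasMatDeriv (fun t => K t j) (D j) ω)
    {ρ : Matrix ((Fin N → n) × a) ((Fin N → n) × a) ℂ} (hρ : ρ.PosSemidef) :
    ∃ L, IsSLD (applyChannel (tensorPow N (K ω)) ρ) (outputVelocity (K ω) D ρ) L ∧
      qfi (fun t => applyChannel (tensorPow N (K t)) ρ) ω
        = (L * L * applyChannel (tensorPow N (K ω)) ρ).trace.re := by
  obtain ⟨L, hL⟩ := exists_isSLD_of_kraus hρ
    (fun s : Fin N → ι => tensorPow N (K ω) s ⊗ₖ (1 : Matrix a a ℂ))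
    (fun s => (∑ k, tensorReplace (K ω) D k s) ⊗ₖ (1 : Matrix a a ℂ))
  refine ⟨L, hL, ?_⟩
  rw [qfi_eq _ _ L]
  rw [(hasMatDeriv_output h ρ).matDeriv_eq]
  exact hL

/-- The Fisher information of a parallel output is bounded in every Hermitian gauge `h`, with a
quadratic term governed by `β(h) = i ∑ⱼ Kⱼ† D'ⱼ`. -/
theorem qfi_output_le [Fintype m] [DecidableEq m] [DecidableEq n] [DecidableEq ι]
    {K : ℝ → ι → Matrix m n ℂ}
    {D : ι → Matrix m n ℂ} {ω : ℝ} (hd : ∀ j, HasMatDeriv (fun t => K t j) (D j) ω)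
    (hK : IsKraus (K ω)) {h : Matrix ι ι ℂ} (hh : h.IsHermitian)
    {ρ : Matrix ((Fin N → n) × a) ((Fin N → n) × a) ℂ} (hρ : IsDensity ρ)
    {D' : ι → Matrix m n ℂ} (hD' : ∀ j, D' j = D j - Complex.I • ∑ l, h j l • K ω l) :
    qfi (fun t => applyChannel (tensorPow N (K t)) ρ) ω
      ≤ 4 * (N * ‖∑ j, (D' j).conjTranspose * D' j‖
        + N ^ 2 * ‖∑ j, (K ω j).conjTranspose * D' j‖ ^ 2) := by
  obtain ⟨L, hL, hq⟩ := exists_isSLD_output hd hρ.1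
  rw [hq]
  have h1 := hL.trace_le hρ.1 (M := fun s => tensorPow N (K ω) s ⊗ₖ (1 : Matrix a a ℂ))
    (E := fun s => (∑ k, tensorReplace (K ω) D' k s) ⊗ₖ (1 : Matrix a a ℂ)) rfl (by
      rw [← outputVelocity_gauge (K ω) D hh ρ, ← funext hD']
      rfl)
  refine h1.trans (mul_le_mul_of_nonneg_left ?_ zero_le_four)
  refine (Complex.re_le_norm _).trans ((norm_trace_mul_le hρ.1 _).trans ?_)
  rw [hρ.2, Complex.one_re, mul_one]
  simp only [kronecker_one_conjTranspose_mul]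
  rw [← sum_kronecker]
  exact (NonUnitalStarAlgHom.norm_apply_le (kroneckerOneHom (Fin N → n) a) _).trans
    (norm_sum_tensorReplace_le hK D')

end Output

/-! ### Exchange of vector families with equal Gram matrices -/

section Isometry

variable {m n κ : Type*} [Fintype m] [Fintype n] [Fintype κ] [DecidableEq κ]

/-- The pseudo-inverse is the inverse in the functional calculus, where `0⁻¹ = 0`. -/
theorem exists_pseudoinverse {G : Matrix κ κ ℂ} (hG : G.IsHermitian) :
    ∃ R : Matrix κ κ ℂ, R.IsHermitian ∧ G * R * G = G := by
  have hGs : IsSelfAdjoint G := hG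
  have hc : ∀ f : ℝ → ℝ, ContinuousOn f (spectrum ℝ G) := fun f =>
    (Matrix.finite_real_spectrum (𝕜 := ℂ) (A := G)).continuousOn f
  refine ⟨cfc (fun x : ℝ => x⁻¹) G, cfc_predicate (p := IsSelfAdjoint) _ G, ?_⟩
  calc G * cfc (fun x : ℝ => x⁻¹) G * G
      = cfc (fun x : ℝ => x) G * cfc (fun x : ℝ => x⁻¹) G * cfc (fun x : ℝ => x) G := by
        rw [cfc_id' ℝ G]
    _ = cfc (fun x : ℝ => x * x⁻¹ * x) G := by
        rw [← cfc_mul _ _ G (hc _) (hc _), ← cfc_mul _ _ G (hc _) (hc _)]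
    _ = G := by simp_rw [mul_inv_mul_cancel]; exact cfc_id' ℝ G

/-- Two families of vectors, the columns of `U` and of `V`, which are orthogonal to each other and
have the same Gram matrix `G` are exchanged by a Hermitian operator, up to the phases `±i`: it is
built from the partial isometry `V G⁺ U†`, where `G⁺` is the pseudo-inverse. -/
theorem exists_hermitian_exchange (U V : Matrix m κ ℂ)
    (hG : U.conjTranspose * U = V.conjTranspose * V) (h0 : V.conjTranspose * U = 0) :
    ∃ X : Matrix m m ℂ, X.IsHermitian ∧ X * U = Complex.I • V ∧ X * V = -Complex.I • U := by
  obtain ⟨R, hRh, hGRG⟩ := exists_pseudoinverse (Matrix.isHermitian_conjTranspose_mul_self V)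
  obtain ⟨G, hGdef⟩ : ∃ G, V.conjTranspose * V = G := ⟨_, rfl⟩
  rw [hGdef] at hGRG hG
  -- `W (1 - R G)` has vanishing Gram matrix for `W = U` and `W = V`
  have hkill : ∀ W : Matrix m κ ℂ, W.conjTranspose * W = G → W * R * G = W := by
    intro W hW
    rw [← sub_eq_zero, ← Matrix.conjTranspose_mul_self_eq_zero]
    have : W.conjTranspose * (W * R * G - W) = 0 := by
      have h : W.conjTranspose * (W * R * G) = W.conjTranspose * W * R * G := by
        simp only [Matrix.mul_assoc]
      rw [Matrix.mul_sub, h, hW, hGRG, sub_self]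
    rw [Matrix.conjTranspose_sub, Matrix.conjTranspose_mul, Matrix.conjTranspose_mul,
      Matrix.sub_mul, this, Matrix.mul_assoc, Matrix.mul_assoc, this, Matrix.mul_zero,
      Matrix.mul_zero, sub_zero]
  have h0' : U.conjTranspose * V = 0 := by
    rw [← Matrix.conjTranspose_conjTranspose V, ← Matrix.conjTranspose_mul, h0,
      Matrix.conjTranspose_zero]
  refine ⟨Complex.I • (V * R * U.conjTranspose - U * R * V.conjTranspose), ?_, ?_, ?_⟩
  · rw [Matrix.IsHermitian, Matrix.conjTranspose_smul, Matrix.conjTranspose_sub]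
    simp only [Matrix.conjTranspose_mul, Matrix.conjTranspose_conjTranspose, hRh.eq,
      Complex.star_def, Complex.conj_I, Matrix.mul_assoc]
    module
  · rw [Matrix.smul_mul, Matrix.sub_mul, Matrix.mul_assoc _ _ U, Matrix.mul_assoc _ _ U, hG, h0,
      hkill V hGdef, Matrix.mul_zero, sub_zero]
  · rw [Matrix.smul_mul, Matrix.sub_mul, Matrix.mul_assoc _ _ V, Matrix.mul_assoc _ _ V, h0',
      hGdef, hkill U hG, Matrix.mul_zero, zero_sub, neg_smul, smul_neg]

/-- The exchange operator for the error vectors of two code words under the same operators `M s`. -/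
theorem exists_hermitian_exchange_mulVec (M : κ → Matrix m n ℂ) (u v : n → ℂ)
    (hG : ∀ s t, star u ⬝ᵥ ((M s).conjTranspose * M t).mulVec u
      = star v ⬝ᵥ ((M s).conjTranspose * M t).mulVec v)
    (h0 : ∀ s t, star v ⬝ᵥ ((M s).conjTranspose * M t).mulVec u = 0) :
    ∃ X : Matrix m m ℂ, X.IsHermitian ∧
      (∀ s, X.mulVec ((M s).mulVec u) = Complex.I • (M s).mulVec v) ∧
      ∀ s, X.mulVec ((M s).mulVec v) = -Complex.I • (M s).mulVec u := by
  let T : (n → ℂ) → Matrix m κ ℂ := fun w => Matrix.of fun i s => (M s).mulVec w i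
  have hT : ∀ w w' s t, ((T w).conjTranspose * T w') s t
      = star w ⬝ᵥ ((M s).conjTranspose * M t).mulVec w' := by
    intro w w' s t
    rw [← Matrix.mulVec_mulVec, Matrix.dotProduct_mulVec, ← Matrix.star_mulVec]
    rfl
  obtain ⟨X, hX, hXu, hXv⟩ := exists_hermitian_exchange (T u) (T v)
    (by ext s t; rw [hT, hT, hG]) (by ext s t; rw [hT, h0]; rfl)
  refine ⟨X, hX, fun s => ?_, fun s => ?_⟩
  · ext i
    exact congrFun (congrFun hXu i) s
  · ext i
    exact congrFun (congrFun hXv i) s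

theorem trace_mul_vecMulVec_star (A : Matrix n n ℂ) (u v : n → ℂ) :
    (A * Matrix.vecMulVec u (star v)).trace = star v ⬝ᵥ A.mulVec u := by
  rw [Matrix.mul_vecMulVec, Matrix.trace_vecMulVec, dotProduct_comm]

omit [Fintype m] in
theorem mul_ketBra_mul_conjTranspose (A B : Matrix m n ℂ) (ψ : n → ℂ) :
    A * ketBra ψ * B.conjTranspose = Matrix.vecMulVec (A.mulVec ψ) (star (B.mulVec ψ)) := by
  rw [ketBra, Matrix.mul_vecMulVec, Matrix.vecMulVec_mul, Matrix.star_mulVec]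

omit [DecidableEq κ] in
/-- Lower bound for the Fisher information of a pure input `ψ`, by an observable `X` that maps each
error state `M s ψ` to the error state `M s φ` of another vector. -/
theorem IsSLD.le_trace_of_mulVec [DecidableEq n] {M E : κ → Matrix m n ℂ} {ψ φ : n → ℂ} {L X : Matrix m m ℂ}
    (hL : IsSLD (∑ s, M s * ketBra ψ * (M s).conjTranspose)
      (∑ s, (E s * ketBra ψ * (M s).conjTranspose + M s * ketBra ψ * (E s).conjTranspose)) L)
    (hX : X.IsHermitian) (hXφ : ∀ s, X.mulVec ((M s).mulVec ψ) = (M s).mulVec φ)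
    (hM : ∑ s, (M s).conjTranspose * M s = 1) (hφ : star φ ⬝ᵥ φ = 1) :
    (2 * (star φ ⬝ᵥ (∑ s, (M s).conjTranspose * E s).mulVec ψ).re) ^ 2
      ≤ (L * L * ∑ s, M s * ketBra ψ * (M s).conjTranspose).trace.re := by
  set z := star φ ⬝ᵥ (∑ s, (M s).conjTranspose * E s).mulVec ψ with hz
  -- the multiple `θ • X` with the best variational lower bound
  set θ : ℝ := 2 * z.re with hθ
  have hpsd : (∑ s, M s * ketBra ψ * (M s).conjTranspose).PosSemidef :=
    Matrix.posSemidef_sum _ fun s _ =>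
      (Matrix.posSemidef_vecMulVec_self_star ψ).mul_mul_conjTranspose_same _
  have h1 : (X * ∑ s, (E s * ketBra ψ * (M s).conjTranspose
      + M s * ketBra ψ * (E s).conjTranspose)).trace = z + star z := by
    have e1 : ∀ s, (X * (E s * ketBra ψ * (M s).conjTranspose)).trace
        = star φ ⬝ᵥ ((M s).conjTranspose * E s).mulVec ψ := by
      intro s
      rw [mul_ketBra_mul_conjTranspose, trace_mul_vecMulVec_star, Matrix.dotProduct_mulVec]
      have := congrArg star (hXφ s)
      rw [Matrix.star_mulVec, hX.eq] at this
      rw [this, Matrix.star_mulVec, ← Matrix.dotProduct_mulVec, Matrix.mulVec_mulVec]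
    have e2 : ∀ s, (X * (M s * ketBra ψ * (E s).conjTranspose)).trace
        = star (star φ ⬝ᵥ ((M s).conjTranspose * E s).mulVec ψ) := by
      intro s
      rw [mul_ketBra_mul_conjTranspose, trace_mul_vecMulVec_star, hXφ, ← Matrix.mulVec_mulVec,
        Matrix.dotProduct_mulVec (star φ), ← Matrix.star_mulVec, Matrix.star_dotProduct]
    rw [Finset.mul_sum, Matrix.trace_sum]
    simp only [mul_add, Matrix.trace_add, e1, e2, Finset.sum_add_distrib]
    rw [← star_sum, ← dotProduct_sum, ← Matrix.sum_mulVec]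
  have h2 : (X * X * ∑ s, M s * ketBra ψ * (M s).conjTranspose).trace = 1 := by
    have e1 : ∀ s, (X * X * (M s * ketBra ψ * (M s).conjTranspose)).trace
        = star φ ⬝ᵥ ((M s).conjTranspose * M s).mulVec φ := by
      intro s
      have := congrArg star (hXφ s)
      rw [Matrix.star_mulVec, hX.eq] at this
      rw [mul_ketBra_mul_conjTranspose, trace_mul_vecMulVec_star, ← Matrix.mulVec_mulVec, hXφ,
        Matrix.dotProduct_mulVec, this, Matrix.star_mulVec, ← Matrix.dotProduct_mulVec,
        Matrix.mulVec_mulVec]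
    rw [Finset.mul_sum, Matrix.trace_sum, Finset.sum_congr rfl fun s _ => e1 s, ← dotProduct_sum,
      ← Matrix.sum_mulVec, hM, Matrix.one_mulVec, hφ]
  have hθX : ((θ : ℂ) • X).IsHermitian := by
    rw [Matrix.IsHermitian, Matrix.conjTranspose_smul, hX.eq, Complex.star_def,
      Complex.conj_ofReal]
  have h3 := hL.le_trace hpsd hθX
  simp only [Matrix.smul_mul, Matrix.mul_smul, Matrix.trace_smul] at h3
  rw [h1, h2] at h3
  simp only [smul_eq_mul, Complex.re_ofReal_mul, Complex.add_re, Complex.star_def, Complex.conj_re,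
    Complex.ofReal_re, mul_one] at h3
  nlinarith

end Isometry

/-! ### Logical states -/

section Product

variable {m n a : Type*} [Fintype n] [Fintype a] {N : ℕ}

/-- The product vector `v₁ ⊗ ⋯ ⊗ v_N` of vectors of probe and ancilla, with all the probes collected
in the first tensor factor. -/
def prodVec (v : Fin N → n × a → ℂ) : (Fin N → n) × (Fin N → a) → ℂ :=
  fun x => ∏ k, v k (x.1 k, x.2 k)

theorem kronecker_one_mulVec_apply [DecidableEq a] (A : Matrix m n ℂ) (w : n × a → ℂ)
    (x : m × a) : (A ⊗ₖ (1 : Matrix a a ℂ)).mulVec w x = ∑ y, A x.1 y * w (y, x.2) := by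
  rw [Matrix.mulVec, dotProduct, Fintype.sum_prod_type]
  refine Finset.sum_congr rfl fun y _ => ?_
  rw [Finset.sum_eq_single x.2]
  · simp
  · intro b _ hb
    simp [Matrix.one_apply_ne (Ne.symm hb)]
  · simp

theorem tensorProd_mulVec_prodVec [DecidableEq a] (A : Fin N → Matrix m n ℂ)
    (w : Fin N → n × a → ℂ) :
    (tensorProd A ⊗ₖ (1 : Matrix (Fin N → a) (Fin N → a) ℂ)).mulVec (prodVec w)
      = prodVec fun k => (A k ⊗ₖ (1 : Matrix a a ℂ)).mulVec (w k) := by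
  classical
  ext x
  simp only [kronecker_one_mulVec_apply, prodVec, tensorProd, Matrix.of_apply,
    ← Finset.prod_mul_distrib]
  rw [Finset.prod_univ_sum, Fintype.piFinset_univ]

theorem star_prodVec_dotProduct (v w : Fin N → n × a → ℂ) :
    star (prodVec v) ⬝ᵥ prodVec w = ∏ k, star (v k) ⬝ᵥ w k := by
  classical
  have h : ∀ k, star (v k) ⬝ᵥ w k = ∑ i, ∑ j, star (v k (i, j)) * w k (i, j) := fun k =>
    Fintype.sum_prod_type _
  simp only [h, Finset.prod_univ_sum, Fintype.piFinset_univ]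
  rw [dotProduct, Fintype.sum_prod_type]
  refine Finset.sum_congr rfl fun x _ => Finset.sum_congr rfl fun y _ => ?_
  simp only [prodVec, Pi.star_apply, star_prod, Finset.prod_mul_distrib]

theorem star_prodVec_dotProduct_mulVec [DecidableEq a] (v w : Fin N → n × a → ℂ)
    (A : Fin N → Matrix n n ℂ) :
    star (prodVec v) ⬝ᵥ
        (tensorProd A ⊗ₖ (1 : Matrix (Fin N → a) (Fin N → a) ℂ)).mulVec (prodVec w)
      = ∏ k, star (v k) ⬝ᵥ (A k ⊗ₖ (1 : Matrix a a ℂ)).mulVec (w k) := by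
  rw [tensorProd_mulVec_prodVec, star_prodVec_dotProduct]

end Product

section LogicalStates

variable {d d' r N : ℕ}

theorem star_logicalKet_dotProduct_mulVec (A B Q : Matrix (Fin d) (Fin d) ℂ) (b c : Fin 2) :
    star (logicalKet A b) ⬝ᵥ
        (Q ⊗ₖ (1 : Matrix (Fin d × Fin 2) (Fin d × Fin 2) ℂ)).mulVec (logicalKet B c)
      = if b = c then (A.conjTranspose * Q * B).trace else 0 := by
  have h1 : star (logicalKet A b) ⬝ᵥ
        (Q ⊗ₖ (1 : Matrix (Fin d × Fin 2) (Fin d × Fin 2) ℂ)).mulVec (logicalKet B c)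
      = ∑ i, ∑ j, ∑ e : Fin 2, star (if e = b then A i j else 0) *
          ∑ y, Q i y * (if e = c then B y j else 0) := by
    rw [dotProduct, Fintype.sum_prod_type]
    refine Finset.sum_congr rfl fun i _ => ?_
    rw [Fintype.sum_prod_type]
    refine Finset.sum_congr rfl fun j _ => Finset.sum_congr rfl fun e _ => ?_
    rw [kronecker_one_mulVec_apply]
    rfl
  rw [h1]
  split_ifs with h
  · subst h
    rw [Matrix.mul_assoc, Matrix.trace, Finset.sum_comm]
    refine Finset.sum_congr rfl fun j _ => ?_
    rw [Matrix.diag_apply, Matrix.mul_apply]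
    refine Finset.sum_congr rfl fun i _ => ?_
    rw [Finset.sum_eq_single b (fun e _ he => by simp [he]) (by simp)]
    simp [Matrix.mul_apply]
  · refine Finset.sum_eq_zero fun i _ => Finset.sum_eq_zero fun j _ =>
      Finset.sum_eq_zero fun e _ => ?_
    by_cases he : e = b
    · simp [he, h]
    · simp [he]

theorem star_logicalKet_dotProduct (A B : Matrix (Fin d) (Fin d) ℂ) (b c : Fin 2) :
    star (logicalKet A b) ⬝ᵥ logicalKet B c
      = if b = c then (A.conjTranspose * B).trace else 0 := by
  have := star_logicalKet_dotProduct_mulVec A B 1 b c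
  rwa [Matrix.one_kronecker_one, Matrix.one_mulVec, mul_one] at this

/-- The two code matrices give the same expectation to any observable orthogonal to the
difference of their density matrices. -/
theorem trace_conjTranspose_mul_mul_sub (A₀ A₁ Q : Matrix (Fin d) (Fin d) ℂ) :
    (A₀.conjTranspose * Q * A₀).trace - (A₁.conjTranspose * Q * A₁).trace
      = (Q * (A₀ * A₀.conjTranspose - A₁ * A₁.conjTranspose)).trace := by
  rw [Matrix.mul_sub, Matrix.trace_sub, Matrix.trace_mul_cycle,
    Matrix.trace_mul_cycle A₁.conjTranspose, Matrix.trace_mul_comm Q, Matrix.trace_mul_comm Q]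

theorem ketBra_mul_mul_vecMulVec {n : Type*} [Fintype n] (u v : n → ℂ) (Q : Matrix n n ℂ) :
    ketBra u * Q * ketBra v = (star u ⬝ᵥ Q.mulVec v) • Matrix.vecMulVec u (star v) := by
  rw [ketBra, ketBra, Matrix.mul_assoc, Matrix.mul_vecMulVec, Matrix.vecMulVec_mul_vecMulVec,
    Matrix.vecMulVec_smul]

theorem knillLaflamme_of_orthogonal {K : Fin r → Matrix (Fin d') (Fin d) ℂ}
    {A₀ A₁ : Matrix (Fin d) (Fin d) ℂ}
    (h : ∀ i j, (((K i).conjTranspose * K j) *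
      (A₀ * A₀.conjTranspose - A₁ * A₁.conjTranspose)).trace = 0) :
    KnillLaflamme K A₀ A₁ := by
  intro i j
  have h1 := trace_conjTranspose_mul_mul_sub A₀ A₁ ((K i).conjTranspose * K j)
  rw [h, sub_eq_zero] at h1
  refine ⟨(A₁.conjTranspose * ((K i).conjTranspose * K j) * A₁).trace, ?_⟩
  rw [codeProj, add_mul, add_mul, mul_add, mul_add]
  simp only [ketBra_mul_mul_vecMulVec, star_logicalKet_dotProduct_mulVec]
  simp [h1, ketBra]

/-- The product vector `|b_L⟩^{⊗N}`. -/
def logicalPow (A : Matrix (Fin d) (Fin d) ℂ) (b : Fin 2) (N : ℕ) :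
    (Fin N → Fin d) × (Fin N → Fin d × Fin 2) → ℂ :=
  prodVec fun _ => logicalKet A b

theorem logicalGHZ_eq (A₀ A₁ : Matrix (Fin d) (Fin d) ℂ) (N : ℕ) :
    logicalGHZ A₀ A₁ N
      = ((Real.sqrt 2 : ℝ) : ℂ)⁻¹ • (logicalPow A₀ 0 N + logicalPow A₁ 1 N) := rfl

theorem star_logicalPow_dotProduct_mulVec (A B : Matrix (Fin d) (Fin d) ℂ) (b c : Fin 2)
    (Q : Fin N → Matrix (Fin d) (Fin d) ℂ) :
    star (logicalPow A b N) ⬝ᵥ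
        (tensorProd Q ⊗ₖ (1 : Matrix (Fin N → Fin d × Fin 2) (Fin N → Fin d × Fin 2) ℂ)).mulVec
          (logicalPow B c N)
      = ∏ k, if b = c then (A.conjTranspose * Q k * B).trace else 0 := by
  rw [logicalPow, logicalPow, star_prodVec_dotProduct_mulVec]
  simp only [star_logicalKet_dotProduct_mulVec]

theorem star_logicalPow_dotProduct (A B : Matrix (Fin d) (Fin d) ℂ) (b c : Fin 2) :
    star (logicalPow A b N) ⬝ᵥ logicalPow B c N
      = ∏ _k : Fin N, if b = c then (A.conjTranspose * B).trace else 0 := by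
  rw [logicalPow, logicalPow, star_prodVec_dotProduct]
  simp only [star_logicalKet_dotProduct]

/-- Orthogonality of the branches needs at least one copy: the empty product is `1`. -/
theorem prod_ite_eq_zero_of_ne {b c : Fin 2} (hbc : b ≠ c) (hN : 1 ≤ N) (z : Fin N → ℂ) :
    (∏ k, if b = c then z k else 0) = 0 :=
  Finset.prod_eq_zero (Finset.mem_univ (⟨0, hN⟩ : Fin N)) (if_neg hbc)

theorem inv_sqrt_two_mul_self :
    ((Real.sqrt 2 : ℝ) : ℂ)⁻¹ * ((Real.sqrt 2 : ℝ) : ℂ)⁻¹ = 1 / 2 := by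
  rw [← mul_inv, ← Complex.ofReal_mul, Real.mul_self_sqrt zero_le_two]
  norm_num

theorem star_inv_sqrt_two :
    star ((Real.sqrt 2 : ℝ) : ℂ)⁻¹ = ((Real.sqrt 2 : ℝ) : ℂ)⁻¹ := by
  rw [star_inv₀, Complex.star_def, Complex.conj_ofReal]

variable {A₀ A₁ : Matrix (Fin d) (Fin d) ℂ} (hA₀ : (A₀.conjTranspose * A₀).trace = 1)
  (hA₁ : (A₁.conjTranspose * A₁).trace = 1)

include hA₀ hA₁ in
theorem isDensity_ketBra_logicalGHZ (hN : 1 ≤ N) : IsDensity (ketBra (logicalGHZ A₀ A₁ N)) := by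
  refine ⟨Matrix.posSemidef_vecMulVec_self_star _, ?_⟩
  rw [ketBra, Matrix.trace_vecMulVec, dotProduct_comm, logicalGHZ_eq, star_smul, star_add,
    smul_dotProduct, dotProduct_smul, add_dotProduct, dotProduct_add, dotProduct_add]
  simp only [star_logicalPow_dotProduct]
  rw [prod_ite_eq_zero_of_ne (by decide) hN, prod_ite_eq_zero_of_ne (by decide) hN,
    star_inv_sqrt_two, smul_eq_mul, smul_eq_mul, ← mul_assoc, inv_sqrt_two_mul_self]
  simp only [if_true, hA₀, hA₁, Finset.prod_const_one]
  norm_num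

theorem siteHom_expectation {A : Matrix (Fin d) (Fin d) ℂ}
    (hA : (A.conjTranspose * A).trace = 1) (b : Fin 2) (B : Matrix (Fin d) (Fin d) ℂ)
    (k : Fin N) :
    star (logicalPow A b N) ⬝ᵥ
        (siteHom k B ⊗ₖ (1 : Matrix (Fin N → Fin d × Fin 2) (Fin N → Fin d × Fin 2) ℂ)).mulVec
          (logicalPow A b N) = (A.conjTranspose * B * A).trace := by
  rw [siteHom_apply, star_logicalPow_dotProduct_mulVec]
  rw [Finset.prod_eq_single k]
  · simp
  · intro i _ hi
    simp [hi, hA]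
  · simp

include hA₀ hA₁ in
/-- The Fisher information of the logical GHZ state: the observable exchanges the two branches of
the superposition within each error space. -/
theorem le_ghzQFI {K : ℝ → Fin r → Matrix (Fin d') (Fin d) ℂ} {ω : ℝ} (hK : IsKraus (K ω))
    (hd : ∀ j a b, DifferentiableAt ℝ (fun t => K t j a b) ω)
    (h : ∀ i j, (((K ω i).conjTranspose * K ω j) *
      (A₀ * A₀.conjTranspose - A₁ * A₁.conjTranspose)).trace = 0) (hN : 1 ≤ N) :
    (N * (krausHamiltonian K ω * (A₀ * A₀.conjTranspose - A₁ * A₁.conjTranspose)).trace.re) ^ 2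
      ≤ ghzQFI K ω A₀ A₁ N := by
  set D : Fin r → Matrix (Fin d') (Fin d) ℂ := fun j => matDeriv (fun t => K t j) ω with hD
  have hD' : ∀ j, HasMatDeriv (fun t => K t j) (D j) ω := fun j => hasMatDeriv_matDeriv (hd j)
  set B : Matrix (Fin d) (Fin d) ℂ := ∑ j, (K ω j).conjTranspose * D j with hB
  obtain ⟨L, hL, hq⟩ := exists_isSLD_output hD'
    (Matrix.posSemidef_vecMulVec_self_star (logicalGHZ A₀ A₁ N))
  let a := Fin N → Fin d × Fin 2
  let M : (Fin N → Fin r) → Matrix ((Fin N → Fin d') × a) ((Fin N → Fin d) × a) ℂ :=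
    fun s => tensorPow N (K ω) s ⊗ₖ (1 : Matrix a a ℂ)
  have hMM : ∀ s t, (M s).conjTranspose * M t
      = tensorProd (fun k => (K ω (s k)).conjTranspose * K ω (t k)) ⊗ₖ (1 : Matrix a a ℂ) := by
    intro s t
    rw [kronecker_one_conjTranspose_mul, tensorPow_eq, tensorPow_eq, conjTranspose_tensorProd,
      tensorProd_mul]
  obtain ⟨X, hX, hX0, hX1⟩ := exists_hermitian_exchange_mulVec M (logicalPow A₀ 0 N)
    (logicalPow A₁ 1 N) (by
      intro s t
      rw [hMM, star_logicalPow_dotProduct_mulVec, star_logicalPow_dotProduct_mulVec]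
      refine Finset.prod_congr rfl fun k _ => ?_
      rw [if_pos rfl, if_pos rfl, ← sub_eq_zero, trace_conjTranspose_mul_mul_sub, h]) (by
      intro s t
      rw [hMM, star_logicalPow_dotProduct_mulVec, prod_ite_eq_zero_of_ne (by decide) hN])
  set c : ℂ := ((Real.sqrt 2 : ℝ) : ℂ)⁻¹ with hc
  set φ := (Complex.I * c) • (logicalPow A₁ 1 N - logicalPow A₀ 0 N) with hφdef
  have hφs : star φ
      = (-Complex.I * c) • (star (logicalPow A₁ 1 N) - star (logicalPow A₀ 0 N)) := by
    rw [hφdef, star_smul, star_mul', star_inv_sqrt_two, star_sub, Complex.star_def,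
      Complex.conj_I]
  have hXφ : ∀ s, X.mulVec ((M s).mulVec (logicalGHZ A₀ A₁ N)) = (M s).mulVec φ := by
    intro s
    rw [logicalGHZ_eq, ← hc, Matrix.mulVec_smul, Matrix.mulVec_smul, Matrix.mulVec_add,
      Matrix.mulVec_add, hX0, hX1, hφdef, Matrix.mulVec_smul, Matrix.mulVec_sub]
    module
  have hφ : star φ ⬝ᵥ φ = 1 := by
    rw [hφs, hφdef, smul_dotProduct, dotProduct_smul, sub_dotProduct, dotProduct_sub,
      dotProduct_sub]
    simp only [star_logicalPow_dotProduct]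
    rw [prod_ite_eq_zero_of_ne (by decide) hN, prod_ite_eq_zero_of_ne (by decide) hN]
    simp only [if_true, hA₀, hA₁, Finset.prod_const_one, smul_eq_mul]
    linear_combination 2 * inv_sqrt_two_mul_self - 2 * c * c * Complex.I_sq
  have hMone : ∑ s, (M s).conjTranspose * M s = 1 := by
    simp only [M, kronecker_one_conjTranspose_mul]
    rw [← sum_kronecker, isKraus_tensorPow hK, Matrix.one_kronecker_one]
  have hle := IsSLD.le_trace_of_mulVec (M := M)
    (E := fun s => (∑ k, tensorReplace (K ω) D k s) ⊗ₖ (1 : Matrix a a ℂ)) hL hX hXφ hMone hφ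
  have hME : ∑ s, (M s).conjTranspose *
      ((∑ k, tensorReplace (K ω) D k s) ⊗ₖ (1 : Matrix a a ℂ))
      = ∑ k, siteHom k B ⊗ₖ (1 : Matrix a a ℂ) := by
    simp only [M, kronecker_one_conjTranspose_mul, Matrix.mul_sum]
    rw [← sum_kronecker, Finset.sum_comm, ← sum_kronecker]
    simp only [sum_tensorPow_conjTranspose_mul_tensorReplace hK, hB]
  have hcross : ∀ (A A' : Matrix (Fin d) (Fin d) ℂ) (b b' : Fin 2), b ≠ b' → ∀ k : Fin N,
      star (logicalPow A b N) ⬝ᵥ (siteHom k B ⊗ₖ (1 : Matrix a a ℂ)).mulVec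
        (logicalPow A' b' N) = 0 := by
    intro A A' b b' hb k
    rw [siteHom_apply, star_logicalPow_dotProduct_mulVec, prod_ite_eq_zero_of_ne hb hN]
  -- the branches contribute opposite signs and the cross terms vanish
  have hval : star φ ⬝ᵥ (∑ k, siteHom k B ⊗ₖ (1 : Matrix a a ℂ)).mulVec (logicalGHZ A₀ A₁ N)
      = N / 2 * (krausHamiltonian K ω *
        (A₀ * A₀.conjTranspose - A₁ * A₁.conjTranspose)).trace := by
    have hH : krausHamiltonian K ω = Complex.I • B := rfl
    rw [Matrix.sum_mulVec, dotProduct_sum, hH, Matrix.smul_mul, Matrix.trace_smul,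
      ← trace_conjTranspose_mul_mul_sub, logicalGHZ_eq, ← hc, hφs]
    have : ∀ k : Fin N, ((-Complex.I * c) •
        (star (logicalPow A₁ 1 N) - star (logicalPow A₀ 0 N))) ⬝ᵥ
        (siteHom k B ⊗ₖ (1 : Matrix a a ℂ)).mulVec
          (c • (logicalPow A₀ 0 N + logicalPow A₁ 1 N))
        = 1 / 2 * (Complex.I * ((A₀.conjTranspose * B * A₀).trace
          - (A₁.conjTranspose * B * A₁).trace)) := by
      intro k
      rw [Matrix.mulVec_smul, smul_dotProduct, dotProduct_smul, Matrix.mulVec_add, sub_dotProduct,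
        dotProduct_add, dotProduct_add, hcross A₁ A₀ 1 0 (by decide),
        hcross A₀ A₁ 0 1 (by decide),       siteHom_expectation hA₀, siteHom_expectation hA₁, smul_eq_mul, smul_eq_mul]
      linear_combination Complex.I * ((A₀.conjTranspose * B * A₀).trace
          - (A₁.conjTranspose * B * A₁).trace) * inv_sqrt_two_mul_self
    rw [Finset.sum_congr rfl fun k _ => this k, Finset.sum_const, Finset.card_univ,
      Fintype.card_fin, nsmul_eq_mul, smul_eq_mul]
    ring
  rw [hME, hval] at hle
  rw [ghzQFI]
  refine le_trans (le_of_eq ?_) (hle.trans hq.symm.le)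
  congr 1
  rw [show (N : ℂ) / 2 = ((N / 2 : ℝ) : ℂ) by push_cast; rfl, Complex.re_ofReal_mul]
  ring

end LogicalStates

/-! ### Change of ancilla, Kraus Hamiltonian and Kraus span -/

section Ancilla

variable {m n a b ι : Type*} [Fintype ι] [Fintype m] [Fintype n] [Fintype a] [Fintype b]
  [DecidableEq a] [DecidableEq b]

omit [Fintype m] [Fintype a] [Fintype b] [Fintype ι] [DecidableEq a] [DecidableEq b] in
theorem trace_submatrix_equiv {n' : Type*} [Fintype n'] (A : Matrix n n ℂ) (e : n' ≃ n) :
    (A.submatrix e e).trace = A.trace :=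
  Equiv.sum_comp e fun i => A i i

theorem qfi_submatrix {n' : Type*} [Fintype n'] {ρ : ℝ → Matrix n n ℂ} {ω : ℝ} {L : Matrix n n ℂ}
    (hL : IsSLD (ρ ω) (matDeriv ρ ω) L) (e : n' ≃ n) :
    qfi (fun t => (ρ t).submatrix e e) ω = qfi ρ ω := by
  rw [qfi_eq ρ ω L hL, qfi_eq _ ω (L.submatrix e e)]
  · rw [Matrix.submatrix_mul_equiv, Matrix.submatrix_mul_equiv, trace_submatrix_equiv]
  · refine ⟨hL.1.submatrix e, ?_⟩
    rw [Matrix.submatrix_mul_equiv, Matrix.submatrix_mul_equiv]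
    exact congrArg (fun A : Matrix n n ℂ => A.submatrix e e) hL.2

omit [Fintype m] in
theorem applyChannel_submatrix (K : ι → Matrix m n ℂ) (ρ : Matrix (n × a) (n × a) ℂ)
    (e : b ≃ a) :
    applyChannel K (ρ.submatrix ((Equiv.refl n).prodCongr e) ((Equiv.refl n).prodCongr e))
      = (applyChannel K ρ).submatrix ((Equiv.refl m).prodCongr e)
          ((Equiv.refl m).prodCongr e) := by
  have h : ∀ i, K i ⊗ₖ (1 : Matrix b b ℂ) = (K i ⊗ₖ (1 : Matrix a a ℂ)).submatrix
      ((Equiv.refl m).prodCongr e) ((Equiv.refl n).prodCongr e) := by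
    intro i
    ext x y
    simp [Matrix.one_apply]
  ext x y
  simp only [applyChannel, h, Matrix.conjTranspose_submatrix, Matrix.submatrix_mul_equiv,
    Matrix.submatrix_apply, Matrix.sum_apply]

end Ancilla

section Kraus

variable {d d' r : ℕ}

/-- `H` is Hermitian because `∑ⱼ Kⱼ† Kⱼ` is constant near `ω`. -/
theorem isHermitian_krausHamiltonian {K : ℝ → Fin r → Matrix (Fin d') (Fin d) ℂ} {ω : ℝ}
    (hK : ∀ᶠ t in 𝓝 ω, IsKraus (K t))
    (hd : ∀ j a b, DifferentiableAt ℝ (fun t => K t j a b) ω) :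
    (krausHamiltonian K ω).IsHermitian := by
  have h1 : HasMatDeriv (fun t => ∑ j, (K t j).conjTranspose * K t j)
      (∑ j, ((matDeriv (fun t => K t j) ω).conjTranspose * K ω j
        + (K ω j).conjTranspose * matDeriv (fun t => K t j) ω)) ω :=
    HasMatDeriv.sum fun j =>
      (hasMatDeriv_matDeriv (hd j)).conjTranspose.mul (hasMatDeriv_matDeriv (hd j))
  have h2 : ∑ j, ((matDeriv (fun t => K t j) ω).conjTranspose * K ω j
      + (K ω j).conjTranspose * matDeriv (fun t => K t j) ω) = 0 := by
    ext x y
    refine (h1 x y).unique ((hasDerivAt_const ω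
      ((1 : Matrix (Fin d) (Fin d) ℂ) x y)).congr_of_eventuallyEq ?_)
    filter_upwards [hK] with t ht
    rw [ht]
  rw [Finset.sum_add_distrib] at h2
  rw [Matrix.IsHermitian, krausHamiltonian, Matrix.conjTranspose_smul, Matrix.conjTranspose_sum]
  simp only [Matrix.conjTranspose_mul, Matrix.conjTranspose_conjTranspose, Complex.star_def,
    Complex.conj_I]
  rw [eq_neg_of_add_eq_zero_left h2, smul_neg, neg_smul, neg_neg]

theorem krausBeta_eq (K : ℝ → Fin r → Matrix (Fin d') (Fin d) ℂ) (ω : ℝ)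
    (h : Matrix (Fin r) (Fin r) ℂ) :
    krausBeta K ω h
      = krausHamiltonian K ω + ∑ j, ∑ l, h j l • ((K ω j).conjTranspose * K ω l) := by
  rw [krausBeta, krausHamiltonian]
  simp only [Matrix.mul_sub, Matrix.mul_smul, Matrix.mul_sum, Finset.sum_sub_distrib, smul_sub,
    ← Finset.smul_sum, smul_smul, Complex.I_mul_I]
  rw [neg_one_smul, sub_neg_eq_add]

/-- Hermitian combinations of the `Kᵢ† Kⱼ` may be taken with a Hermitian matrix of coefficients. -/
theorem mem_krausSpan_iff {K : Fin r → Matrix (Fin d') (Fin d) ℂ} {S : Matrix (Fin d) (Fin d) ℂ} :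
    S ∈ krausSpan K ↔ ∃ h : Matrix (Fin r) (Fin r) ℂ, h.IsHermitian ∧
      S = ∑ j, ∑ l, h j l • ((K j).conjTranspose * K l) := by
  have hadj : ∀ g : Matrix (Fin r) (Fin r) ℂ,
      (∑ j, ∑ l, g j l • ((K j).conjTranspose * K l)).conjTranspose
        = ∑ j, ∑ l, g.conjTranspose j l • ((K j).conjTranspose * K l) := by
    intro g
    simp only [Matrix.conjTranspose_sum, Matrix.conjTranspose_smul, Matrix.conjTranspose_mul,
      Matrix.conjTranspose_conjTranspose, Matrix.conjTranspose_apply]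
    exact Finset.sum_comm
  constructor
  · rintro ⟨hS, hmem⟩
    have hex : ∃ g : Matrix (Fin r) (Fin r) ℂ,
        S = ∑ j, ∑ l, g j l • ((K j).conjTranspose * K l) := by
      clear hS
      induction hmem using Submodule.span_induction with
      | mem x hx =>
        obtain ⟨i, j, rfl⟩ := hx
        refine ⟨Matrix.single i j 1, ?_⟩
        rw [Finset.sum_eq_single i, Finset.sum_eq_single j]
        · simp
        · intro l _ hl
          simp [Ne.symm hl]
        · simp
        · intro k _ hk
          simp [Ne.symm hk]
        · simp
      | zero => exact ⟨0, by simp⟩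
      | add x y _ _ hx hy =>
        obtain ⟨g, rfl⟩ := hx
        obtain ⟨g', rfl⟩ := hy
        exact ⟨g + g', by simp only [Matrix.add_apply, add_smul, Finset.sum_add_distrib]⟩
      | smul c x _ hx =>
        obtain ⟨g, rfl⟩ := hx
        exact ⟨c • g, by simp only [Matrix.smul_apply, smul_assoc, Finset.smul_sum]⟩
    obtain ⟨g, rfl⟩ := hex
    refine ⟨(1 / 2 : ℂ) • (g + g.conjTranspose), isHermitian_half_add g, ?_⟩
    have h1 := hadj g
    rw [hS.eq] at h1
    simp only [Matrix.smul_apply, Matrix.add_apply, smul_assoc, add_smul, Finset.sum_add_distrib,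
      ← Finset.smul_sum]
    rw [← h1, ← two_smul ℂ, smul_smul]
    norm_num
  · rintro ⟨h, hh, rfl⟩
    refine ⟨?_, Submodule.sum_mem _ fun j _ => Submodule.sum_mem _ fun l _ =>
      Submodule.smul_mem _ _ (mem_krausProductSpan K j l)⟩
    rw [Matrix.IsHermitian, hadj, hh.eq]

theorem neg_mem_krausSpan {K : Fin r → Matrix (Fin d') (Fin d) ℂ} {S : Matrix (Fin d) (Fin d) ℂ}
    (hS : S ∈ krausSpan K) : -S ∈ krausSpan K :=
  ⟨hS.1.neg, Submodule.neg_mem _ hS.2⟩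

/-- The operators `β(h)` are the differences of `H` and the elements of the Kraus span. -/
theorem exists_krausBeta_iff (K : ℝ → Fin r → Matrix (Fin d') (Fin d) ℂ) (ω : ℝ)
    (f : Matrix (Fin d) (Fin d) ℂ → ℝ) :
    {x | ∃ h : Matrix (Fin r) (Fin r) ℂ, h.IsHermitian ∧ x = f (krausBeta K ω h)}
      = {x | ∃ S ∈ krausSpan (K ω), x = f (krausHamiltonian K ω - S)} := by
  ext x
  constructor
  · rintro ⟨h, hh, rfl⟩
    refine ⟨_, neg_mem_krausSpan (mem_krausSpan_iff.mpr ⟨h, hh, rfl⟩), ?_⟩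
    rw [krausBeta_eq, sub_neg_eq_add]
  · rintro ⟨S, hS, rfl⟩
    obtain ⟨h, hh, hSh⟩ := mem_krausSpan_iff.mp (neg_mem_krausSpan hS)
    refine ⟨h, hh, ?_⟩
    rw [krausBeta_eq, ← hSh, sub_eq_add_neg]

/-- Every element of the Kraus span bounds the Fisher information of all parallel outputs. -/
theorem exists_qfi_le {K : ℝ → Fin r → Matrix (Fin d') (Fin d) ℂ} {ω : ℝ} (hK : IsKraus (K ω))
    (hd : ∀ j a b, DifferentiableAt ℝ (fun t => K t j a b) ω) {S : Matrix (Fin d) (Fin d) ℂ}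
    (hS : S ∈ krausSpan (K ω)) :
    ∃ α : ℝ, ∀ (N : ℕ) (a : Type) [Fintype a] [DecidableEq a]
      (ρ : Matrix ((Fin N → Fin d) × a) ((Fin N → Fin d) × a) ℂ), IsDensity ρ →
      qfi (fun t => applyChannel (tensorPow N (K t)) ρ) ω
        ≤ N * α + N ^ 2 * (4 * ‖krausHamiltonian K ω - S‖ ^ 2) := by
  obtain ⟨h, hh, hSh⟩ := mem_krausSpan_iff.mp (neg_mem_krausSpan hS)
  set D' : Fin r → Matrix (Fin d') (Fin d) ℂ := fun j =>
    matDeriv (fun t => K t j) ω - Complex.I • ∑ l, h j l • K ω l with hD'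
  refine ⟨4 * ‖∑ j, (D' j).conjTranspose * D' j‖, fun N a _ _ ρ hρ => ?_⟩
  have h1 := qfi_output_le (fun j => hasMatDeriv_matDeriv (hd j)) hK hh hρ (D' := D')
    fun j => rfl
  have h2 : ‖∑ j, (K ω j).conjTranspose * D' j‖ = ‖krausHamiltonian K ω - S‖ := by
    have : krausHamiltonian K ω - S = Complex.I • ∑ j, (K ω j).conjTranspose * D' j := by
      rw [sub_eq_add_neg, hSh, ← krausBeta_eq]
      rfl
    rw [this, norm_smul, Complex.norm_I, one_mul]
  rw [h2] at h1
  linarith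

/-- Any finite ancilla may be relabelled by `Fin a`. -/
theorem qfi_mem_parallelQFISet {K : ℝ → Fin r → Matrix (Fin d') (Fin d) ℂ} {ω : ℝ}
    (hd : ∀ j a b, DifferentiableAt ℝ (fun t => K t j a b) ω) {N : ℕ} {a : Type} [Fintype a]
    [DecidableEq a] {ρ : Matrix ((Fin N → Fin d) × a) ((Fin N → Fin d) × a) ℂ}
    (hρ : IsDensity ρ) :
    qfi (fun t => applyChannel (tensorPow N (K t)) ρ) ω ∈ parallelQFISet K ω N := by
  have e := (Fintype.equivFin a).symm
  refine ⟨Fintype.card a, ρ.submatrix ((Equiv.refl _).prodCongr e) ((Equiv.refl _).prodCongr e),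
    ⟨hρ.1.submatrix _, ?_⟩, ?_⟩
  · rw [trace_submatrix_equiv, hρ.2]
  · have hD := fun j => hasMatDeriv_matDeriv (hd j)
    obtain ⟨L, hL, -⟩ := exists_isSLD_output hD hρ.1
    rw [← (hasMatDeriv_output hD ρ).matDeriv_eq] at hL
    simp only [applyChannel_submatrix]
    exact (qfi_submatrix hL _).symm

theorem exists_isDensity {n : Type*} [Fintype n] [DecidableEq n] [Nonempty n] :
    ∃ ρ : Matrix n n ℂ, IsDensity ρ := by
  obtain ⟨i⟩ := ‹Nonempty n›
  refine ⟨ketBra (Pi.single i 1), Matrix.posSemidef_vecMulVec_self_star _, ?_⟩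
  rw [ketBra, Matrix.trace_vecMulVec, ← Pi.single_star]
  simp

theorem tendsto_of_quadratic_bounds {f : ℕ → ℝ} {F α : ℝ}
    (hlow : ∀ N : ℕ, 1 ≤ N → (N : ℝ) ^ 2 * F ≤ f N)
    (hup : ∀ N : ℕ, 1 ≤ N → f N ≤ N * α + (N : ℝ) ^ 2 * F) :
    Tendsto (fun N : ℕ => f N / (N : ℝ) ^ 2) atTop (𝓝 F) := by
  have h1 : Tendsto (fun N : ℕ => α / (N : ℝ) + F) atTop (𝓝 F) := by
    simpa using (tendsto_const_div_atTop_nhds_zero_nat α).add_const F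
  refine tendsto_of_tendsto_of_tendsto_of_le_of_le' tendsto_const_nhds h1 ?_ ?_
  · filter_upwards [eventually_ge_atTop 1] with N hN
    have : (0 : ℝ) < N := by exact_mod_cast hN
    rw [le_div_iff₀ (by positivity), mul_comm]
    exact hlow N hN
  · filter_upwards [eventually_ge_atTop 1] with N hN
    have : (0 : ℝ) < N := by exact_mod_cast hN
    rw [div_le_iff₀ (by positivity)]
    refine (hup N hN).trans_eq ?_
    field_simp

theorem isLeast_comp_norm_sub {T : Set (Matrix (Fin d) (Fin d) ℂ)}
    {H S₀ : Matrix (Fin d) (Fin d) ℂ}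
    (hS₀ : S₀ ∈ T) (hmin : ∀ S ∈ T, ‖H - S₀‖ ≤ ‖H - S‖) {g : ℝ → ℝ}
    (hg : MonotoneOn g (Set.Ici 0)) :
    IsLeast {x | ∃ S ∈ T, x = g ‖H - S‖} (g ‖H - S₀‖) := by
  refine ⟨⟨S₀, hS₀, rfl⟩, ?_⟩
  rintro x ⟨S, hS, rfl⟩
  exact hg (norm_nonneg _) (norm_nonneg _) (hmin S hS)

end Kraus

end ChannelMetrology

theorem theorem3 {d d' r : ℕ} (K : ℝ → Fin r → Matrix (Fin d') (Fin d) ℂ) (ω : ℝ)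
    (hK : ∀ᶠ t in 𝓝 ω, IsKraus (K t))
    (hd : ∀ j a b, DifferentiableAt ℝ (fun t => K t j a b) ω)
    (hH : krausHamiltonian K ω ∉ krausSpan (K ω)) :
    ∃ F : ℝ,
      -- the asymptotic value, as two attained minima
      IsLeast {x | ∃ h : Matrix (Fin r) (Fin r) ℂ, h.IsHermitian ∧
        x = 4 * opNorm (krausBeta K ω h) ^ 2} F ∧
      IsLeast {x | ∃ S ∈ krausSpan (K ω),
        x = 4 * opNorm (krausHamiltonian K ω - S) ^ 2} F ∧
      -- the `N`-channel quantum Fisher information is a genuine (finite) supremum, and its limit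
      (∀ N, IsLUB (parallelQFISet K ω N) (parallelQFI K ω N)) ∧
      Tendsto (fun N : ℕ => parallelQFI K ω N / (N : ℝ) ^ 2) atTop (𝓝 F) ∧
      -- the semidefinite program is solvable, and its solutions solve the trace-norm program
      (∃ p, IsSDPOptimal K ω p) ∧
      (∀ p, IsSDPOptimal K ω p →
        IsCodeOptimal K ω (p.1 - p.2)) ∧
      -- strong duality: the optimal value is twice the operator-norm distance
      (∀ C, IsCodeOptimal K ω C →
        IsLeast {x | ∃ S ∈ krausSpan (K ω),
          x = 2 * opNorm (krausHamiltonian K ω - S)}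
          ‖(krausHamiltonian K ω * C).trace‖) ∧
      -- every solution comes from a code
      (∀ C, IsCodeOptimal K ω C → ∃ A₀ A₁ : Matrix (Fin d) (Fin d) ℂ,
        (A₀.conjTranspose * A₀).trace = 1 ∧ (A₁.conjTranspose * A₁).trace = 1 ∧
          A₀ * A₀.conjTranspose - A₁ * A₁.conjTranspose = C) ∧
      -- every such code satisfies the Knill-Laflamme condition, and its GHZ state is optimal
      (∀ A₀ A₁ : Matrix (Fin d) (Fin d) ℂ,
        (A₀.conjTranspose * A₀).trace = 1 → (A₁.conjTranspose * A₁).trace = 1 →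
        IsCodeOptimal K ω
          (A₀ * A₀.conjTranspose - A₁ * A₁.conjTranspose) →
        KnillLaflamme (K ω) A₀ A₁ ∧
        (∀ N, 1 ≤ N → IsDensity
          (ketBra (logicalGHZ A₀ A₁ N))) ∧
        (∀ N : ℕ, 1 ≤ N → (N : ℝ) ^ 2 * F ≤ ghzQFI K ω A₀ A₁ N) ∧
        Tendsto (fun N : ℕ => ghzQFI K ω A₀ A₁ N / (N : ℝ) ^ 2) atTop (𝓝 F)) := by
  obtain ⟨S₀, hS₀, hmin⟩ := exists_nearest (krausProductSpan (K ω)) (krausHamiltonian K ω)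
  have hKω : IsKraus (K ω) := hK.self_of_nhds
  have hHh := isHermitian_krausHamiltonian hK hd
  -- in dimension `0` every matrix lies in the Kraus span
  have hd0 : d ≠ 0 := by
    rintro rfl
    rw [Subsingleton.elim (krausHamiltonian K ω) 1] at hH
    exact hH (one_mem_krausSpan hKω)
  have : NeZero d := ⟨hd0⟩
  obtain ⟨α, hup⟩ := exists_qfi_le hKω hd hS₀
  have hmono : MonotoneOn (fun x : ℝ => 4 * x ^ 2) (Set.Ici 0) := fun x hx y _ hxy => by
    have : x ^ 2 ≤ y ^ 2 := pow_le_pow_left₀ hx hxy 2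
    simpa using this
  have hleast := isLeast_comp_norm_sub hS₀ hmin hmono
  have hbdd : ∀ N, ∀ x ∈ parallelQFISet K ω N,
      x ≤ N * α + (N : ℝ) ^ 2 * (4 * ‖krausHamiltonian K ω - S₀‖ ^ 2) := by
    rintro N x ⟨a, ρ, hρ, rfl⟩
    exact hup N (Fin a) ρ hρ
  have hlub : ∀ N, IsLUB (parallelQFISet K ω N) (parallelQFI K ω N) := by
    intro N
    obtain ⟨ρ, hρ⟩ := exists_isDensity (n := (Fin N → Fin d) × Fin 1)
    exact isLUB_csSup ⟨_, qfi_mem_parallelQFISet hd hρ⟩ ⟨_, hbdd N⟩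
  have hzero : ∀ C, IsCodeOptimal K ω C → ∀ i j,
      (((K ω i).conjTranspose * K ω j) * C).trace = 0 := by
    intro C hC i j
    rw [Matrix.trace_mul_comm]
    exact trace_mul_eq_zero hC.1.2.2 (mem_krausProductSpan (K ω) i j)
  have hval : ∀ C, IsCodeOptimal K ω C →
      (krausHamiltonian K ω * C).trace.re ^ 2 = 4 * ‖krausHamiltonian K ω - S₀‖ ^ 2 := by
    intro C hC
    have him : (krausHamiltonian K ω * C).trace.im = 0 := by
      rw [← Complex.conj_eq_iff_im, ← Complex.star_def, ← Matrix.trace_conjTranspose,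
        Matrix.conjTranspose_mul, hHh.eq, hC.1.1.eq, Matrix.trace_mul_comm]
    have h := congrArg (· ^ 2) (norm_trace_of_isCodeOptimal hHh hS₀ hmin hC)
    simp only [Complex.sq_norm, Complex.normSq_apply, him] at h
    linarith
  have hghz : ∀ A₀ A₁ : Matrix (Fin d) (Fin d) ℂ,
      (A₀.conjTranspose * A₀).trace = 1 → (A₁.conjTranspose * A₁).trace = 1 →
      IsCodeOptimal K ω (A₀ * A₀.conjTranspose - A₁ * A₁.conjTranspose) → ∀ N : ℕ, 1 ≤ N →
      (N : ℝ) ^ 2 * (4 * ‖krausHamiltonian K ω - S₀‖ ^ 2) ≤ ghzQFI K ω A₀ A₁ N := by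
    intro A₀ A₁ hA₀ hA₁ hC N hN
    rw [← hval _ hC, ← mul_pow]
    exact le_ghzQFI hA₀ hA₁ hKω hd (hzero _ hC) hN
  obtain ⟨p, hp⟩ := exists_isSDPOptimal hHh hS₀ hmin
  have hpC := isCodeOptimal_of_isSDPOptimal hHh hS₀ hmin hp
  obtain ⟨A₀, A₁, hA₀, hA₁, hA⟩ := exists_code_of_isCodeOptimal hHh hS₀ hmin hKω hH hpC
  refine ⟨4 * ‖krausHamiltonian K ω - S₀‖ ^ 2, ?_, hleast, hlub, ?_, ⟨p, hp⟩,
    fun q hq => isCodeOptimal_of_isSDPOptimal hHh hS₀ hmin hq, fun C hC => ?_,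
    fun C hC => exists_code_of_isCodeOptimal hHh hS₀ hmin hKω hH hC,
    fun A₀ A₁ hA₀ hA₁ hC => ⟨knillLaflamme_of_orthogonal (hzero _ hC),
      fun N hN => isDensity_ketBra_logicalGHZ hA₀ hA₁ hN, hghz A₀ A₁ hA₀ hA₁ hC, ?_⟩⟩
  · rw [exists_krausBeta_iff K ω fun A => 4 * opNorm A ^ 2]
    exact hleast
  · refine tendsto_of_quadratic_bounds (α := α) (fun N hN => ?_) fun N _ =>
      (isLUB_le_iff (hlub N)).mpr (hbdd N)
    exact (hghz A₀ A₁ hA₀ hA₁ (hA ▸ hpC) N hN).trans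
      ((hlub N).1 (qfi_mem_parallelQFISet hd (isDensity_ketBra_logicalGHZ hA₀ hA₁ hN)))
  · rw [norm_trace_of_isCodeOptimal hHh hS₀ hmin hC]
    exact isLeast_comp_norm_sub hS₀ hmin (g := fun x => 2 * x) fun x _ y _ hxy => by
      simpa using hxy
  · refine tendsto_of_quadratic_bounds (α := α) (hghz A₀ A₁ hA₀ hA₁ hC) fun N hN => ?_
    exact hup N _ _ (isDensity_ketBra_logicalGHZ hA₀ hA₁ hN)
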